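/- Let $M\cong\mathbb Z^2$ be a lattice and let $\Delta\subseteq M\otimes\mathbb Q$ be a full-dimensional lattice polygon (the convex hull of finitely many points of $M$, not contained in a line) such that $S:=\Delta\cap M$ satisfies $|S|\ge 6$. Write $S=\{p_0,\dots,p_n\}$, let $X\subseteq\mathbb P^n$ be the toric surface obtained as the closure of the image of $(\mathbb C^*)^2\to\mathbb P^n$, $u\mapsto[\chi^{p_0}(u):\dots:\chi^{p_n}(u)]$, let $H$ be its hyperplane class, and let $\mathbf 1\in X$ be the image of the neutral element of $(\mathbb C^*)^2$. Let $\pi:\tilde X\to X$ be the blow-up of $X$ at $\mathbf 1$, with exceptional divisor $E\cong\mathbb P^1$. The second fundamental form of $X$ at $\mathbf 1$ is the linear system of binary quadratic forms given by the image of the restriction map $H^0(\tilde X,\mathcal O(\pi^*H-2E))\to H^0(E,\mathcal O(\pi^*H-2E))\cong H^0(\mathbb P^1,\mathcal O(2))$; it is full dimensional if this image is the whole space. The linear system $|\pi^*H-3E|$ is special if its dimension $h^0(\pi^*H-3E)-1$ is bigger than the expected dimension $\max\{\dim|H|-6,\,-1\}$. Then the following are equivalent: 1. the second fundamental form of $X$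 at $\mathbf 1$ is not full dimensional; 2. the linear system $|\pi^*H-3E|$ is special; 3. up to a transformation $x\mapsto Ax+t$ with $A\in\operatorname{GL}(2,\mathbb Z)$ and $t\in\mathbb Z^2$, the polygon $\Delta$ is the convex hull of one of the following sets of points, with $a,b\in\mathbb Z$: - (i) $(0,0),(0,1),(a,1),(b,0)$ with $b\ge a\ge 1$ and $a+b\ge 4$; - (ii) $(0,0),(0,1),(a,0)$ with $a\ge 4$; - (iii) $(a,0),(0,1),(-b,0),(0,-1)$ with $a\ge 1$, $b\ge 0$ and $a+b\ge 3$; - (iv) $(a,0),(0,1),(-b,0),(-1,-1)$ with $a\ge 1$, $b\ge 0$ and $a+b\ge 3$. Moreover, the second fundamental form of $X$ at $\mathbf 1$ has non-empty base locus in $\mathbb P^1$ if and only if $\Delta$ is of type (i) or (ii). -/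

import Mathlib

/-!
Projective toric varieties of finite sets of lattice points, their blow-up at the unit point of the
torus, and higher fundamental forms. All varieties below are integral with function field
`ℂ(u₁, …, u_k)`; they are described by the coordinate rings of an affine open cover, as subrings of
that field.
-/

/-- The field of rational functions of the torus `(ℂ^*)^k`, i.e. the fraction field of the ring of
Laurent polynomials `ℂ[ℤ^k]`. -/
abbrev TorusField (k : ℕ) : Type :=
  FractionRing (AddMonoidAlgebra ℂ (Fin k → ℤ))

namespace TorusField

/-- The Laurent monomial `χ^p` as a rational function. -/
noncomputable def chi {k : ℕ} (p : Fin k → ℤ) : TorusField k :=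
  algebraMap (AddMonoidAlgebra ℂ (Fin k → ℤ)) (TorusField k) (AddMonoidAlgebra.single p 1)

/-- The local coordinate `u_i - 1` at the unit point `𝟏` of the torus. The functions
`u_1 - 1, …, u_k - 1` generate the maximal ideal of `𝟏` in the Laurent polynomial ring. -/
noncomputable def loc {k : ℕ} (i : Fin k) : TorusField k :=
  chi (Pi.single i 1) - 1

end TorusField

open TorusField

/-- A Cartier divisor on an integral variety with function field `K`, given by the coordinate rings
`chart i ⊆ K` of an affine open cover and a local equation `eqn i` of the divisor on every chart. -/
structure ChartedDivisor (K : Type) [Field K] [Algebra ℂ K] where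
  ι : Type
  chart : ι → Subalgebra ℂ K
  eqn : ι → K

/-- `H⁰(X, 𝒪(D))`: the rational functions `f` such that `f · eqn i` is regular on every chart. -/
noncomputable def ChartedDivisor.globalSections {K : Type} [Field K] [Algebra ℂ K]
    (D : ChartedDivisor K) : Submodule ℂ K :=
  ⨅ i, (Subalgebra.toSubmodule (D.chart i)).comap (LinearMap.mulLeft ℂ (D.eqn i))

/-- The dimension `h⁰(D) - 1` of the complete linear system `|D|`. -/
noncomputable def ChartedDivisor.dimLinearSystem {K : Type} [Field K] [Algebra ℂ K]
    (D : ChartedDivisor K) : ℤ :=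
  (Module.finrank ℂ D.globalSections : ℤ) - 1

namespace ToricVariety

variable {k : ℕ}

/-- For `X(S) ⊆ ℙ^n`, the closure of the image of `u ↦ [χ^p(u)]_{p ∈ S}`, the coordinate ring
`ℂ[χ^(q-p) : q ∈ S]` of the affine open subset `U_p` of `X(S)` where the `p`-th homogeneous
coordinate does not vanish. -/
noncomputable def affineChart (S : Set (Fin k → ℤ)) (p : Fin k → ℤ) :
    Subalgebra ℂ (TorusField k) :=
  Algebra.adjoin ℂ {f | ∃ q ∈ S, f = chi (q - p)}

/-- The hyperplane section `H` of `X(S)`: on `U_p`, the sheaf `𝒪(H) = 𝒪(1)` is generated by the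
`p`-th homogeneous coordinate `χ^p`. -/
noncomputable def hyperplane (S : Set (Fin k → ℤ)) : ChartedDivisor (TorusField k) where
  ι := S
  chart p := affineChart S p
  eqn p := chi (-p.1)

/-- The open subset of `U_p` where `χ^(q-p) ≠ 1`. For `p ≠ q` in `S` these sets cover
`X(S) ∖ {𝟏}`. -/
noncomputable def awayChart (S : Set (Fin k → ℤ)) (p q : Fin k → ℤ) :
    Subalgebra ℂ (TorusField k) :=
  affineChart S p ⊔ Algebra.adjoin ℂ {(chi (q - p) - 1)⁻¹}

/-- The chart `ℂ[u₁^±, …, u_k^±][(u_j - 1)/(u_i - 1) : j]` of the blow-up of the torus at `𝟏`,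
in which the exceptional divisor has equation `u_i - 1 = 0`. -/
noncomputable def blowUpChart (i : Fin k) : Subalgebra ℂ (TorusField k) :=
  Algebra.adjoin ℂ (Set.range chi ∪ {f | ∃ j, f = loc j / loc i})

/-- The divisor `π^*H - mE` on the blow-up `π : X̃ → X(S)` at `𝟏`. The variety `X̃` is covered by
the charts of `X(S) ∖ {𝟏}` and those of the blow-up of the torus at `𝟏`; the divisor `H` is
trivial on the torus, with equation `1`, and `E` is given by `u_i - 1` on the `i`-th chart. -/
noncomputable def blowUpDivisor (S : Set (Fin k → ℤ)) (m : ℕ) :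
    ChartedDivisor (TorusField k) where
  ι := {pq : S × S // pq.1 ≠ pq.2} ⊕ Fin k
  chart := Sum.elim (fun pq => awayChart S pq.1.1 pq.1.2) blowUpChart
  eqn := Sum.elim (fun pq => chi (-pq.1.1.1)) (fun i => (loc i ^ m)⁻¹)

/-- The expected dimension of `|π^*H - mE|`: a point of multiplicity `m` imposes `C(m+k-1, k)`
conditions on `|H|`, and the empty linear system has dimension `-1`. -/
noncomputable def expectedDim (S : Set (Fin k → ℤ)) (m : ℕ) : ℤ :=
  max ((hyperplane S).dimLinearSystem - ((m + k - 1).choose k : ℤ)) (-1)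

/-- `|π^*H - mE|` is special: its dimension is bigger than the expected one. -/
def IsSpecial (S : Set (Fin k → ℤ)) (m : ℕ) : Prop :=
  expectedDim S m < (blowUpDivisor S m).dimLinearSystem

/-- The homogeneous form `F` of degree `m` on `E = ℙ^(k-1)` (with homogeneous coordinates
`w_j = (u_j - 1)|_E`) is the restriction to `E` of the section `f` of `𝒪(π^*H - mE)`: on the `i`-th
chart, where `f = (u_i - 1)^m g` and `E` is `u_i - 1 = 0`, the function `g|_E` is the
dehomogenization `F(w_1/w_i, …, w_k/w_i)`. -/
def RestrictsTo (m : ℕ) (f : TorusField k) (F : MvPolynomial (Fin k) ℂ) : Prop :=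
  ∀ i : Fin k, ∃ h ∈ blowUpChart i,
    f / loc i ^ m - MvPolynomial.aeval (fun j => loc j / loc i) F = loc i * h

/-- The `m`-th fundamental form of `X(S)` at `𝟏`: the linear system of forms of degree `m` on
`ℙ^(k-1)` which is the image of the restriction map
`H⁰(X̃, 𝒪(π^*H - mE)) → H⁰(E, 𝒪(π^*H - mE))`. -/
def fundamentalForm (S : Set (Fin k → ℤ)) (m : ℕ) : Submodule ℂ (MvPolynomial (Fin k) ℂ) where
  carrier := {F | F ∈ MvPolynomial.homogeneousSubmodule (Fin k) ℂ m ∧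
    ∃ f ∈ (blowUpDivisor S m).globalSections, RestrictsTo m f F}
  add_mem' := by
    rintro F G ⟨hF, f, hf, hfF⟩ ⟨hG, g, hg, hgG⟩
    refine ⟨add_mem hF hG, f + g, add_mem hf hg, fun i => ?_⟩
    obtain ⟨a, ha, ha'⟩ := hfF i
    obtain ⟨b, hb, hb'⟩ := hgG i
    refine ⟨a + b, add_mem ha hb, ?_⟩
    rw [map_add, mul_add, ← ha', ← hb']
    ring
  zero_mem' := ⟨zero_mem _, 0, zero_mem _, fun i => ⟨0, zero_mem _, by simp⟩⟩
  smul_mem' := by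
    rintro c F ⟨hF, f, hf, hfF⟩
    refine ⟨Submodule.smul_mem _ c hF, c • f, Submodule.smul_mem _ c hf, fun i => ?_⟩
    obtain ⟨a, ha, ha'⟩ := hfF i
    refine ⟨c • a, Subalgebra.smul_mem _ ha c, ?_⟩
    rw [map_smul, mul_smul_comm, ← ha', smul_sub, smul_div_assoc]

/-- The `m`-th fundamental form is full dimensional: it is the complete linear system of forms of
degree `m` on `ℙ^(k-1)`. -/
def IsFullDimensionalForm (S : Set (Fin k → ℤ)) (m : ℕ) : Prop :=
  fundamentalForm S m = MvPolynomial.homogeneousSubmodule (Fin k) ℂ m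

/-- The base locus in `ℙ^(k-1)` of the `m`-th fundamental form. -/
def baseLocus (S : Set (Fin k → ℤ)) (m : ℕ) : Set (Projectivization ℂ (Fin k → ℂ)) :=
  {x | ∀ F ∈ fundamentalForm S m, MvPolynomial.eval x.rep F = 0}

end ToricVariety

namespace LatticePolytope

variable {k : ℕ}

/-- The inclusion of the lattice `ℤ^k` in `ℚ^k`. -/
def toRat (p : Fin k → ℤ) : Fin k → ℚ := fun i => (p i : ℚ)

/-- A full-dimensional lattice polytope: the convex hull of finitely many lattice points, not
contained in a proper affine subspace. -/
def IsFullDimLatticePolytope (Δ : Set (Fin k → ℚ)) : Prop :=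
  (∃ V : Finset (Fin k → ℤ), Δ = convexHull ℚ (toRat '' (V : Set (Fin k → ℤ)))) ∧
    affineSpan ℚ Δ = ⊤

/-- The set `Δ ∩ M` of lattice points of `Δ`. -/
def latticePoints (Δ : Set (Fin k → ℚ)) : Set (Fin k → ℤ) :=
  {p | toRat p ∈ Δ}

/-- `P` is the image of `Q` under an affine transformation `x ↦ A x + t` of the lattice, with
`A ∈ GL(k, ℤ)` and `t ∈ ℤ^k`. -/
def UnimodularEquivalent (P Q : Set (Fin k → ℚ)) : Prop :=
  ∃ (A : GL (Fin k) ℤ) (t : Fin k → ℤ),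
    P = (fun x => ((A : Matrix (Fin k) (Fin k) ℤ).map (Int.cast : ℤ → ℚ)).mulVec x + toRat t) '' Q

/-- Type (i): the polygon with vertices `(0,0), (0,1), (a,1), (b,0)`. -/
def IsTypeI (Δ : Set (Fin 2 → ℚ)) : Prop :=
  ∃ a b : ℤ, 1 ≤ a ∧ a ≤ b ∧ 4 ≤ a + b ∧
    UnimodularEquivalent Δ
      (convexHull ℚ (toRat '' {![0, 0], ![0, 1], ![a, 1], ![b, 0]}))

/-- Type (ii): the triangle with vertices `(0,0), (0,1), (a,0)`. -/
def IsTypeII (Δ : Set (Fin 2 → ℚ)) : Prop :=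
  ∃ a : ℤ, 4 ≤ a ∧
    UnimodularEquivalent Δ
      (convexHull ℚ (toRat '' {![0, 0], ![0, 1], ![a, 0]}))

/-- Type (iii): the convex hull of `(a,0), (0,1), (-b,0), (0,-1)`. -/
def IsTypeIII (Δ : Set (Fin 2 → ℚ)) : Prop :=
  ∃ a b : ℤ, 1 ≤ a ∧ 0 ≤ b ∧ 3 ≤ a + b ∧
    UnimodularEquivalent Δ
      (convexHull ℚ (toRat '' {![a, 0], ![0, 1], ![-b, 0], ![0, -1]}))

/-- Type (iv): the convex hull of `(a,0), (0,1), (-b,0), (-1,-1)`. -/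
def IsTypeIV (Δ : Set (Fin 2 → ℚ)) : Prop :=
  ∃ a b : ℤ, 1 ≤ a ∧ 0 ≤ b ∧ 3 ≤ a + b ∧
    UnimodularEquivalent Δ
      (convexHull ℚ (toRat '' {![a, 0], ![0, 1], ![-b, 0], ![-1, -1]}))

end LatticePolytope

open ToricVariety LatticePolytope

/-! ### Farkas' lemma and separation of points from polytopes -/

/-- Farkas' lemma for finitely many vectors over a linearly ordered field. -/
theorem farkas {K E ι : Type*} [Field K] [LinearOrder K] [IsStrictOrderedRing K]
    [AddCommGroup E] [Module K E] (s : Finset ι) (a : ι → E) (b : E) :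
    (∃ c : ι → K, (∀ i ∈ s, 0 ≤ c i) ∧ b = ∑ i ∈ s, c i • a i) ∨
      ∃ f : E →ₗ[K] K, (∀ i ∈ s, 0 ≤ f (a i)) ∧ f b < 0 := by
  classical
  induction s using Finset.induction_on generalizing a b with
  | empty =>
    by_cases hb : b = 0
    · exact Or.inl ⟨0, by simp, by simp [hb]⟩
    · obtain ⟨f, hf⟩ := not_forall.1 (mt (Module.forall_dual_apply_eq_zero_iff K b).1 hb)
      rcases lt_or_gt_of_ne hf with h | h
      · exact Or.inr ⟨f, by simp, h⟩
      · exact Or.inr ⟨-f, by simp, by simpa using h⟩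
  | insert v s hv ih =>
    rcases ih a b with ⟨c, hc, hb⟩ | ⟨f, hf, hfb⟩
    · refine Or.inl ⟨Function.update c v 0, fun i hi => ?_, ?_⟩
      · rcases eq_or_ne i v with rfl | h
        · simp
        · simpa [h] using hc i ((Finset.mem_insert.1 hi).resolve_left h)
      · rw [Finset.sum_insert hv, hb]
        simp only [Function.update_self, zero_smul, zero_add]
        exact Finset.sum_congr rfl fun i hi => by
          rw [Function.update_of_ne (ne_of_mem_of_not_mem hi hv)]
    · by_cases hfv : 0 ≤ f (a v)
      · exact Or.inr ⟨f, by simpa [hfv] using hf, hfb⟩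
      · push Not at hfv
        -- The projection along `a v` onto the kernel of `f`. A cone relation between projected
        -- vectors lifts with a nonnegative coefficient at `a v`, because `f` is negative at `a v`
        -- and `b` and nonnegative at the other vectors; a separating functional pulls back to one
        -- that vanishes at `a v`.
        let P : E →ₗ[K] E := LinearMap.id - (f.smulRight ((f (a v))⁻¹ • a v))
        have hP : ∀ x, P x = x - (f x * (f (a v))⁻¹) • a v := fun x => by
          simp [P, smul_smul]
        rcases ih (fun i => P (a i)) (P b) with ⟨c, hc, hb⟩ | ⟨g, hg, hgb⟩
        · left
          have hinv : (f (a v))⁻¹ < 0 := inv_lt_zero.2 hfv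
          refine ⟨Function.update c v
            (f b * (f (a v))⁻¹ + ∑ i ∈ s, c i * (-(f (a i) * (f (a v))⁻¹))), fun i hi => ?_, ?_⟩
          · rcases eq_or_ne i v with rfl | h
            · simp only [Function.update_self]
              refine add_nonneg (mul_nonneg_of_nonpos_of_nonpos hfb.le hinv.le)
                (Finset.sum_nonneg fun j hj => mul_nonneg (hc j hj) ?_)
              exact neg_nonneg.2 (mul_nonpos_of_nonneg_of_nonpos (hf j hj) hinv.le)
            · simpa [h] using hc i ((Finset.mem_insert.1 hi).resolve_left h)
          · rw [Finset.sum_insert hv, Function.update_self]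
            have : ∑ i ∈ s, Function.update c v
                (f b * (f (a v))⁻¹ + ∑ i ∈ s, c i * (-(f (a i) * (f (a v))⁻¹))) i • a i =
                ∑ i ∈ s, c i • a i :=
              Finset.sum_congr rfl fun i hi => by
                rw [Function.update_of_ne (ne_of_mem_of_not_mem hi hv)]
            rw [this, add_smul, Finset.sum_smul, add_assoc, ← Finset.sum_add_distrib,
              ← sub_eq_iff_eq_add', ← hP, hb]
            refine Finset.sum_congr rfl fun i _ => ?_
            rw [hP, smul_sub, smul_smul, mul_neg, neg_smul, sub_eq_neg_add]
        · refine Or.inr ⟨g.comp P, fun i hi => ?_, hgb⟩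
          rcases Finset.mem_insert.1 hi with rfl | h
          · simp [hP, mul_inv_cancel₀ hfv.ne]
          · exact hg i h

/-- A point outside the convex hull of a finite set is strictly separated from it. -/
theorem exists_separating_functional {K E : Type*} [Field K] [LinearOrder K]
    [IsStrictOrderedRing K] [AddCommGroup E] [Module K E] (V : Finset E) (x : E)
    (hx : x ∉ convexHull K (V : Set E)) :
    ∃ f : E →ₗ[K] K, ∀ v ∈ V, f x < f v := by
  -- Homogenization: `x` lies in the convex hull iff `(x, 1)` lies in the cone over the vectors `(v,
  -- 1)`.
  rcases farkas (K := K) V (fun v => (v, (1 : K))) (x, (1 : K)) with ⟨c, hc, hb⟩ | ⟨f, hf, hfx⟩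
  · refine absurd ?_ hx
    rw [Finset.mem_convexHull']
    refine ⟨c, hc, ?_, ?_⟩
    · simpa [Prod.snd_sum] using (congrArg Prod.snd hb).symm
    · simpa [Prod.fst_sum] using (congrArg Prod.fst hb).symm
  · refine ⟨f.comp (LinearMap.inl K E K), fun v hv => ?_⟩
    have h1 := hf v hv
    have key : ∀ y : E, f (y, 1) = f (y, 0) + f (0, 1) := fun y => by
      rw [← map_add]; simp
    rw [key] at h1 hfx
    simp only [LinearMap.comp_apply, LinearMap.inl_apply]
    linarith

/-! ### Lattice points of full-dimensional polytopes -/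

namespace LatticePolytope

variable {k : ℕ}

/-- `toRat` as an additive homomorphism. -/
def toRatHom (k : ℕ) : (Fin k → ℤ) →+ (Fin k → ℚ) where
  toFun := toRat
  map_zero' := by ext; simp [toRat]
  map_add' x y := by ext; simp [toRat]

variable {Δ : Set (Fin k → ℚ)}

theorem IsFullDimLatticePolytope.convexHull_latticePoints (hΔ : IsFullDimLatticePolytope Δ) :
    convexHull ℚ (toRat '' latticePoints Δ) = Δ := by
  obtain ⟨⟨V, rfl⟩, -⟩ := hΔ
  refine subset_antisymm (convexHull_min ?_ (convex_convexHull ..)) (convexHull_mono ?_)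
  · rintro _ ⟨p, hp, rfl⟩
    exact hp
  · rintro _ ⟨p, hp, rfl⟩
    exact ⟨p, subset_convexHull _ _ ⟨p, hp, rfl⟩, rfl⟩

/-- The affine functions vanishing at all lattice points are trivial. -/
theorem IsFullDimLatticePolytope.eq_zero_of_forall_latticePoints
    (hΔ : IsFullDimLatticePolytope Δ) (f : (Fin k → ℚ) →ₗ[ℚ] ℚ) (c : ℚ)
    (h : ∀ p ∈ latticePoints Δ, f (toRat p) = c) : f = 0 ∧ c = 0 := by
  have h1 : ∀ x ∈ Δ, f x = c := by
    intro x hx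
    rw [← hΔ.convexHull_latticePoints] at hx
    refine convexHull_min (t := {x | f x = c}) ?_ ?_ hx
    · rintro _ ⟨p, hp, rfl⟩
      exact h p hp
    · exact convex_hyperplane f.isLinear c
  have h2 : ∀ x, f x = c := by
    intro x
    have hx : x ∈ affineSpan ℚ Δ := hΔ.2 ▸ AffineSubspace.mem_top ℚ _ x
    refine affineSpan_induction (p := fun x => f x = c) hx h1 fun a x y z hx hy hz => ?_
    simp [hx, hy, hz]
  have hc : c = 0 := by simpa using (h2 0).symm
  exact ⟨LinearMap.ext fun x => by simp [h2, hc], hc⟩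

/-- A separating functional attains its minimum over the polytope at a lattice point `p`. On the
affine chart at this `p` the section `χ^x` is seen not to be regular. -/
theorem IsFullDimLatticePolytope.exists_separating (hΔ : IsFullDimLatticePolytope Δ)
    {x : Fin k → ℤ} (hx : x ∉ latticePoints Δ) :
    ∃ l : (Fin k → ℤ) →+ ℚ, ∃ p ∈ latticePoints Δ,
      (∀ q ∈ latticePoints Δ, l p ≤ l q) ∧ l x < l p := by
  classical
  have hne : (latticePoints Δ).Nonempty := by
    by_contra hempty
    rw [Set.not_nonempty_iff_eq_empty] at hempty
    have := (hΔ.eq_zero_of_forall_latticePoints 0 1 (by simp [hempty])).2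
    exact one_ne_zero this
  obtain ⟨⟨V, hV⟩, -⟩ := id hΔ
  have hVne : V.Nonempty := by
    by_contra h
    rw [Finset.not_nonempty_iff_eq_empty] at h
    obtain ⟨p, hp⟩ := hne
    simp [latticePoints, hV, h] at hp
  have hx' : toRat x ∉ convexHull ℚ ((V.image toRat : Finset (Fin k → ℚ)) : Set (Fin k → ℚ)) := by
    rw [Finset.coe_image, ← hV]
    exact hx
  obtain ⟨f, hf⟩ := exists_separating_functional _ _ hx'
  obtain ⟨p, hpV, hp⟩ := V.exists_min_image (fun v => f (toRat v)) hVne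
  refine ⟨f.toAddMonoidHom.comp (toRatHom k), p, ?_, fun q hq => ?_,
    hf _ (Finset.mem_image_of_mem _ hpV)⟩
  · change toRat p ∈ Δ
    rw [hV]
    exact subset_convexHull _ _ ⟨p, hpV, rfl⟩
  · change toRat q ∈ Δ at hq
    rw [hV] at hq
    refine convexHull_min (t := {x | f (toRat p) ≤ f x}) ?_ ?_ hq
    · rintro _ ⟨v, hv, rfl⟩
      exact hp v hv
    · exact convex_halfSpace_ge f.isLinear _

/-- The lattice points of a polygon do not lie on a complex line. -/
theorem IsFullDimLatticePolytope.line_eq_zero {Δ : Set (Fin 2 → ℚ)}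
    (hΔ : IsFullDimLatticePolytope Δ) (α β γ : ℂ)
    (h : ∀ p ∈ latticePoints Δ, α + β * (p 0 : ℂ) + γ * (p 1 : ℂ) = 0) :
    α = 0 ∧ β = 0 ∧ γ = 0 := by
  have key : ∀ a b c : ℤ, (a ≠ 0 ∨ b ≠ 0) →
      ∃ p ∈ latticePoints Δ, a * p 0 + b * p 1 ≠ c := by
    intro a b c hab
    by_contra! hcon
    have h0 := (hΔ.eq_zero_of_forall_latticePoints
      ((a : ℚ) • LinearMap.proj 0 + (b : ℚ) • LinearMap.proj 1) c fun p hp => by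
        have := hcon p hp
        simp only [LinearMap.add_apply, LinearMap.smul_apply, LinearMap.proj_apply, toRat,
          smul_eq_mul]
        exact_mod_cast this).1
    have ha := LinearMap.congr_fun h0 ![1, 0]
    have hb := LinearMap.congr_fun h0 ![0, 1]
    simp at ha hb
    tauto
  -- Three lattice points not on a line: `q` differs from `p` in the first coordinate and `r` is off
  -- the line through both. Cramer's rule then gives the vanishing of the coefficients.
  obtain ⟨p, hp, -⟩ := key 1 0 0 (by simp)
  obtain ⟨q, hq, hqp⟩ := key 1 0 (p 0) (by simp)
  obtain ⟨r, hr, hrp⟩ := key (q 1 - p 1) (p 0 - q 0)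
    ((q 1 - p 1) * p 0 + (p 0 - q 0) * p 1) (Or.inr (by simp at hqp; omega))
  have hdet : ((q 1 - p 1) * (r 0 - p 0) - (q 0 - p 0) * (r 1 - p 1) : ℂ) ≠ 0 := by
    intro h0
    apply hrp
    have : ((q 1 - p 1) * (r 0 - p 0) - (q 0 - p 0) * (r 1 - p 1) : ℤ) = 0 := by exact_mod_cast h0
    linarith
  have h1 := h p hp
  have h2 := h q hq
  have h3 := h r hr
  have hβ : β = 0 := by
    refine (mul_eq_zero.1 ?_).resolve_right hdet
    linear_combination (q 1 - p 1 : ℂ) * (h3 - h1) - (r 1 - p 1 : ℂ) * (h2 - h1)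
  have hγ : γ = 0 := by
    refine (mul_eq_zero.1 ?_).resolve_right hdet
    linear_combination (r 0 - p 0 : ℂ) * (h2 - h1) - (q 0 - p 0 : ℂ) * (h3 - h1)
  subst hβ hγ
  exact ⟨by simpa using h1, rfl, rfl⟩

end LatticePolytope

/-! ### Laurent polynomials and divisibility by u_i - 1 -/

/-- The Laurent polynomial ring, the coordinate ring of the torus. -/
abbrev Laurent (k : ℕ) : Type := AddMonoidAlgebra ℂ (Fin k → ℤ)

namespace Laurent

variable {k : ℕ}

/-- The Laurent monomials as units. -/
noncomputable def mon (k : ℕ) : Multiplicative (Fin k → ℤ) →* (Laurent k)ˣ :=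
  (AddMonoidAlgebra.of ℂ (Fin k → ℤ)).toHomUnits

theorem coe_mon (p : Fin k → ℤ) :
    (mon k (Multiplicative.ofAdd p) : Laurent k) = AddMonoidAlgebra.single p 1 := rfl

theorem mon_smul (n : ℤ) (p : Fin k → ℤ) :
    mon k (Multiplicative.ofAdd (n • p)) = mon k (Multiplicative.ofAdd p) ^ n := by
  rw [ofAdd_zsmul, map_zpow]

theorem single_add (p q : Fin k → ℤ) :
    (AddMonoidAlgebra.single (p + q) 1 : Laurent k) =
      AddMonoidAlgebra.single p 1 * AddMonoidAlgebra.single q 1 := by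
  rw [AddMonoidAlgebra.single_mul_single, one_mul]

/-- The coordinate `u_i - 1` in the Laurent polynomial ring. -/
noncomputable def coord (i : Fin k) : Laurent k := AddMonoidAlgebra.single (Pi.single i 1) 1 - 1

theorem coord_ne_zero (i : Fin k) : coord i ≠ 0 := by
  intro h
  rw [coord, sub_eq_zero, AddMonoidAlgebra.one_def, AddMonoidAlgebra.single_left_inj one_ne_zero] at h
  simpa using congrFun h i

end Laurent

open Laurent

theorem sub_one_dvd_zpow_sub_one {R : Type*} [CommRing R] (u : Rˣ) (n : ℤ) :
    (u - 1 : R) ∣ ((u ^ n : Rˣ) : R) - 1 := by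
  induction n using Int.induction_on with
  | zero => simp
  | succ n ih =>
    rw [zpow_add_one, Units.val_mul]
    have : (((u ^ (n : ℤ) : Rˣ) : R) * u - 1) = (((u ^ (n : ℤ) : Rˣ) : R) - 1) * u + (u - 1) := by
      ring
    rw [this]
    exact dvd_add (ih.mul_right _) dvd_rfl
  | pred n ih =>
    rw [zpow_sub_one, Units.val_mul]
    have : (((u ^ (-n : ℤ) : Rˣ) : R) * (u⁻¹ : Rˣ) - 1) =
        (((u ^ (-n : ℤ) : Rˣ) : R) - 1) * (u⁻¹ : Rˣ) - (u - 1) * (u⁻¹ : Rˣ) := by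
      rw [sub_mul (u : R), Units.mul_inv]
      ring
    rw [this]
    exact dvd_sub (ih.mul_right _) (dvd_mul_right _ _)

namespace Laurent

variable {k : ℕ}

/-- The additive map which sets the `i`-th exponent to `0`. -/
def dropExp (i : Fin k) : (Fin k → ℤ) →+ (Fin k → ℤ) where
  toFun p := Function.update p i 0
  map_zero' := by simp
  map_add' p q := by
    ext j
    rcases eq_or_ne j i with rfl | h
    · simp
    · simp [h]

/-- The substitution `u_i ↦ 1`. -/
noncomputable def specialize (i : Fin k) : Laurent k →ₐ[ℂ] Laurent k :=
  AddMonoidAlgebra.mapDomainAlgHom ℂ ℂ (dropExp i)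

theorem specialize_single (i : Fin k) (p : Fin k → ℤ) (c : ℂ) :
    specialize i (AddMonoidAlgebra.single p c) =
      AddMonoidAlgebra.single (Function.update p i 0) c := by
  simp [specialize, dropExp]

/-- On a monomial the substitution only replaces the factor u_i^n by 1, and u_i - 1 divides u_i^n -
1 for negative n as well. -/
theorem coord_dvd_sub_specialize (i : Fin k) (g : Laurent k) :
    coord i ∣ g - specialize i g := by
  induction g using AddMonoidAlgebra.induction_linear with
  | zero => simp
  | add f g hf hg =>
    rw [map_add, add_sub_add_comm]
    exact dvd_add hf hg
  | single p c =>
    have hp : p = Function.update p i 0 + p i • Pi.single i 1 := by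
      ext j
      rcases eq_or_ne j i with rfl | h
      · simp
      · simp [h]
    have h1 : (AddMonoidAlgebra.single p c : Laurent k) =
        AddMonoidAlgebra.single (Function.update p i 0) c *
          (mon k (Multiplicative.ofAdd (Pi.single i 1)) ^ (p i) : (Laurent k)ˣ) := by
      rw [← mon_smul, coe_mon, AddMonoidAlgebra.single_mul_single, mul_one, ← hp]
    rw [specialize_single, h1, ← mul_sub_one]
    exact (sub_one_dvd_zpow_sub_one _ _).mul_left _

theorem coord_dvd_iff (i : Fin k) (g : Laurent k) : coord i ∣ g ↔ specialize i g = 0 := by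
  constructor
  · rintro ⟨h, rfl⟩
    have : specialize i (coord i) = 0 := by
      have e : Function.update (Pi.single i 1 : Fin k → ℤ) i 0 = 0 := by
        ext j
        rcases eq_or_ne j i with rfl | h <;> simp [*]
      rw [coord, map_sub, specialize_single, map_one, e, AddMonoidAlgebra.one_def, sub_self]
    rw [map_mul, this, zero_mul]
  · intro h
    simpa [h] using coord_dvd_sub_specialize i g

theorem specialize_coord_of_ne {i j : Fin k} (h : i ≠ j) : specialize i (coord j) = coord j := by
  rw [coord, map_sub, specialize_single, map_one, Function.update_eq_self_iff.2]
  simp [h]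

/-- The elements u_i - 1 and u_j - 1 are coprime: setting u_i = 1 fixes the nonzero element u_j - 1
of a domain, so the factors u_i - 1 of `g` split off one at a time. -/
theorem coord_pow_dvd_of_mul_coord_pow {i j : Fin k} (hij : i ≠ j) (m n : ℕ) (g h : Laurent k)
    (e : g * coord j ^ m = h * coord i ^ n) : coord i ^ n ∣ g := by
  induction n generalizing g with
  | zero => simp
  | succ n ih =>
    have h1 : coord i ∣ g * coord j ^ m := by
      rw [e, pow_succ]
      exact ⟨h * coord i ^ n, by ring⟩
    rw [coord_dvd_iff, map_mul, map_pow, specialize_coord_of_ne hij] at h1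
    have h2 : coord i ∣ g := by
      rw [coord_dvd_iff]
      exact (mul_eq_zero.1 h1).resolve_right (pow_ne_zero _ (coord_ne_zero j))
    obtain ⟨g', rfl⟩ := h2
    rw [pow_succ']
    refine mul_dvd_mul_left _ (ih g' ?_)
    apply mul_left_cancel₀ (coord_ne_zero i)
    rw [← mul_assoc, e]
    ring

/-! ### Half-spaces of exponents -/

/-- Laurent polynomials whose exponents lie in the half-space `0 ≤ l`. -/
noncomputable def halfSpace (l : (Fin k → ℤ) →+ ℚ) : Subalgebra ℂ (Laurent k) where
  carrier := {g | ∀ x, g.coeff x ≠ 0 → 0 ≤ l x}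
  mul_mem' := by
    classical
    intro a b ha hb x hx
    obtain ⟨y, hy, z, hz, rfl⟩ := Finset.mem_add.1
      (AddMonoidAlgebra.support_coeff_mul_subset a b (Finsupp.mem_support_iff.2 hx))
    rw [map_add]
    exact add_nonneg (ha y (Finsupp.mem_support_iff.1 hy)) (hb z (Finsupp.mem_support_iff.1 hz))
  add_mem' := by
    intro a b ha hb x hx
    by_cases h : a.coeff x = 0
    · exact hb x fun h' => hx (by simp [h, h'])
    · exact ha x h
  algebraMap_mem' := by
    classical
    intro r x hx
    have : x = 0 := by
      by_contra h
      apply hx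
      simp [AddMonoidAlgebra.coe_algebraMap, Ne.symm h]
    simp [this]

theorem single_mem_halfSpace {l : (Fin k → ℤ) →+ ℚ} {p : Fin k → ℤ} (h : 0 ≤ l p) (c : ℂ) :
    AddMonoidAlgebra.single p c ∈ halfSpace l := by
  classical
  intro x hx
  rw [AddMonoidAlgebra.coeff_single, Finsupp.single_apply] at hx
  split_ifs at hx with h'
  · exact h' ▸ h
  · exact absurd rfl hx

/-- At exponents y with l(y) < 0 the product has no coefficient, so the coefficients of `g` at y and
y - v agree. Since l(v) ≥ 0 this propagates to all y - nv, and a nonzero coefficient would make the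
support infinite. -/
theorem mem_halfSpace_of_mul_single_sub_one {l : (Fin k → ℤ) →+ ℚ} {v : Fin k → ℤ} (hv : v ≠ 0)
    (hl : 0 ≤ l v) {g : Laurent k} (hg : g * (AddMonoidAlgebra.single v 1 - 1) ∈ halfSpace l) :
    g ∈ halfSpace l := by
  intro x hx
  by_contra! hlx
  have step : ∀ y, l y < 0 → g.coeff y = g.coeff (y - v) := by
    intro y hy
    by_contra hne
    refine hy.not_ge (hg y ?_)
    rw [mul_sub, mul_one, AddMonoidAlgebra.coeff_sub, Finsupp.sub_apply,
      AddMonoidAlgebra.coeff_mul_single_apply, mul_one, ← sub_eq_add_neg]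
    exact sub_ne_zero.2 (Ne.symm hne)
  have all : ∀ n : ℕ, g.coeff (x - n • v) = g.coeff x ∧ l (x - n • v) < 0 := by
    intro n
    induction n with
    | zero => simpa using hlx
    | succ n ih =>
      have e : x - (n + 1) • v = (x - n • v) - v := by rw [succ_nsmul, sub_sub]
      rw [e]
      refine ⟨(step _ ih.2).symm.trans ih.1, ?_⟩
      rw [map_sub]
      linarith [ih.2]
  have hinj : Function.Injective fun n : ℕ => x - n • v := by
    intro m n hmn
    have : (m : ℕ) • v = n • v := sub_right_injective hmn
    obtain ⟨i, hi⟩ := Function.ne_iff.1 hv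
    have := congrFun this i
    simp only [Pi.smul_apply, nsmul_eq_mul, mul_eq_mul_right_iff] at this
    exact_mod_cast this.resolve_right hi
  refine Set.infinite_range_of_injective hinj (g.coeff.support.finite_toSet.subset ?_)
  rintro _ ⟨n, rfl⟩
  exact Finsupp.mem_support_iff.2 ((all n).1.trans_ne hx)

theorem mem_halfSpace_of_mul_pow {l : (Fin k → ℤ) →+ ℚ} {v : Fin k → ℤ} (hv : v ≠ 0)
    (hl : 0 ≤ l v) (n : ℕ) {g : Laurent k}
    (hg : g * (AddMonoidAlgebra.single v 1 - 1) ^ n ∈ halfSpace l) : g ∈ halfSpace l := by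
  induction n with
  | zero => simpa using hg
  | succ n ih =>
    rw [pow_succ, ← mul_assoc] at hg
    exact ih (mem_halfSpace_of_mul_single_sub_one hv hl hg)

end Laurent

/-! ### Taylor expansion at the unit point and restriction to arcs -/

/-- Second order expansion of the integral powers of a unit. -/
theorem exists_zpow_eq_taylor {R : Type*} [CommRing R] [Algebra ℂ R] (u : Rˣ) (n : ℤ) :
    ∃ r : R, ((u ^ n : Rˣ) : R) = 1 + algebraMap ℂ R n * (u - 1) +
      algebraMap ℂ R (n * (n - 1) / 2) * (u - 1) ^ 2 + r * (u - 1) ^ 3 := by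
  induction n using Int.induction_on with
  | zero => exact ⟨0, by simp⟩
  | succ n ih =>
    obtain ⟨r, hr⟩ := ih
    refine ⟨algebraMap ℂ R ((n : ℤ) * ((n : ℤ) - 1) / 2) + r * u, ?_⟩
    have h1 : (((n : ℤ) + 1 : ℤ) * (((n : ℤ) + 1 : ℤ) - 1) / 2 : ℂ) =
        (n : ℤ) * ((n : ℤ) - 1) / 2 + (n : ℤ) := by push_cast; ring
    have h2 : ((((n : ℤ) + 1 : ℤ)) : ℂ) = (n : ℤ) + 1 := by push_cast; ring
    rw [zpow_add_one, Units.val_mul, hr, h1, h2, map_add, map_add, map_one]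
    ring
  | pred n ih =>
    obtain ⟨r, hr⟩ := ih
    set m : ℤ := -(n : ℤ)
    -- By Pascal's rule the quadratic truncation for m - 1, multiplied by u, is the one for m plus
    -- (m-1)(m-2)/2 · (u - 1)³. Dividing by u gives this remainder.
    refine ⟨(u⁻¹ : Rˣ) * (r - algebraMap ℂ R ((m - 1 : ℤ) * ((m - 1 : ℤ) - 1) / 2)), ?_⟩
    have h1 : (m * (m - 1) / 2 : ℂ) =
        (m - 1 : ℤ) * ((m - 1 : ℤ) - 1) / 2 + (m - 1 : ℤ) := by push_cast; ring
    have h2 : (m : ℂ) = (m - 1 : ℤ) + 1 := by push_cast; ring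
    rw [h1, h2, map_add, map_add, map_one] at hr
    rw [zpow_sub_one, Units.val_mul, hr]
    linear_combination (1 + algebraMap ℂ R (m - 1 : ℤ) * ((u : R) - 1) +
      algebraMap ℂ R ((m - 1 : ℤ) * ((m - 1 : ℤ) - 1) / 2) * (u - 1) ^ 2) * u.mul_inv

namespace Laurent

/-- The linear functional on Laurent polynomials with value `q p` at the monomial `χ^p`. -/
noncomputable def moment {k : ℕ} (q : (Fin k → ℤ) → ℂ) : Laurent k →ₗ[ℂ] ℂ :=
  Finsupp.linearCombination ℂ q ∘ₗ (AddMonoidAlgebra.coeffLinearEquiv ℂ).toLinearMap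

theorem moment_single {k : ℕ} (q : (Fin k → ℤ) → ℂ) (p : Fin k → ℤ) (c : ℂ) :
    moment q (AddMonoidAlgebra.single p c) = c * q p := by
  simp [moment]

/-- The basis of the polynomials of degree at most `2` which gives the Taylor coefficients of the
monomials `χ^p` at the unit point. -/
noncomputable def quad (j : Fin 6) (p : Fin 2 → ℤ) : ℂ :=
  ![1, (p 0 : ℂ), (p 1 : ℂ), (p 0 : ℂ) * ((p 0 : ℂ) - 1) / 2, (p 0 : ℂ) * (p 1 : ℂ),
    (p 1 : ℂ) * ((p 1 : ℂ) - 1) / 2] j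

/-- The monomials of degree at most `2` in the local coordinates at the unit point. -/
noncomputable def localMonomial (j : Fin 6) : Laurent 2 :=
  ![1, coord 0, coord 1, coord 0 ^ 2, coord 0 * coord 1, coord 1 ^ 2] j

/-- The maximal ideal of the unit point of the torus. -/
noncomputable def maxIdeal (k : ℕ) : Ideal (Laurent k) := Ideal.span (Set.range coord)

theorem coord_mem_maxIdeal {k : ℕ} (i : Fin k) : coord i ∈ maxIdeal k :=
  Ideal.subset_span ⟨i, rfl⟩

/-- The moments are the Taylor coefficients up to order 2. By linearity this concerns only
monomials, where it follows by multiplying the expansions of the powers of u_0 and u_1. -/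
theorem sub_taylor_mem (g : Laurent 2) :
    g - ∑ j, moment (quad j) g • localMonomial j ∈ maxIdeal 2 ^ 3 := by
  induction g using AddMonoidAlgebra.induction_linear with
  | zero => simp
  | add f g hf hg =>
    simp only [map_add, add_smul, Finset.sum_add_distrib]
    rw [add_sub_add_comm]
    exact add_mem hf hg
  | single p c =>
    have hp : (AddMonoidAlgebra.single p c : Laurent 2) = c • (
        (mon 2 (Multiplicative.ofAdd (Pi.single 0 1)) ^ (p 0) : (Laurent 2)ˣ) *
        (mon 2 (Multiplicative.ofAdd (Pi.single 1 1)) ^ (p 1) : (Laurent 2)ˣ)) := by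
      rw [← mon_smul, ← mon_smul, coe_mon, coe_mon, AddMonoidAlgebra.single_mul_single,
        AddMonoidAlgebra.smul_single]
      congr 1
      · ext j; fin_cases j <;> simp
      · simp
    obtain ⟨r, hr⟩ := exists_zpow_eq_taylor (mon 2 (Multiplicative.ofAdd (Pi.single 0 1))) (p 0)
    obtain ⟨s, hs⟩ := exists_zpow_eq_taylor (mon 2 (Multiplicative.ofAdd (Pi.single 1 1))) (p 1)
    rw [coe_mon] at hr hs
    change _ = 1 + _ * coord 0 + _ * coord 0 ^ 2 + r * coord 0 ^ 3 at hr
    change _ = 1 + _ * coord 1 + _ * coord 1 ^ 2 + s * coord 1 ^ 3 at hs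
    simp only [moment_single]
    rw [hp, hr, hs]
    simp only [mul_smul, ← Finset.smul_sum, ← smul_sub]
    refine Submodule.smul_of_tower_mem _ c ?_
    have hx := coord_mem_maxIdeal (k := 2) 0
    have hy := coord_mem_maxIdeal (k := 2) 1
    have h30 := Ideal.pow_mem_pow hx 3
    have h03 := Ideal.pow_mem_pow hy 3
    have h21 : coord 0 ^ 2 * coord 1 ∈ maxIdeal 2 ^ 3 :=
      pow_succ (maxIdeal 2) 2 ▸ Ideal.mul_mem_mul (Ideal.pow_mem_pow hx 2) hy
    have h12 : coord 1 ^ 2 * coord 0 ∈ maxIdeal 2 ^ 3 :=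
      pow_succ (maxIdeal 2) 2 ▸ Ideal.mul_mem_mul (Ideal.pow_mem_pow hy 2) hx
    simp only [Fin.sum_univ_six, localMonomial, quad, Matrix.cons_val, Algebra.smul_def, map_one]
    rw [map_mul (algebraMap ℂ (Laurent 2)) (p 0 : ℂ) (p 1 : ℂ)]
    generalize algebraMap ℂ (Laurent 2) (p 0) = a
    generalize algebraMap ℂ (Laurent 2) (p 1) = b
    generalize algebraMap ℂ (Laurent 2) (p 0 * (p 0 - 1) / 2) = a'
    generalize algebraMap ℂ (Laurent 2) (p 1 * (p 1 - 1) / 2) = b'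
    generalize (coord 0 : Laurent 2) = x at *
    generalize (coord 1 : Laurent 2) = y at *
    -- All terms of degree at least 3 in the product of the two expansions, grouped as multiples of
    -- x³, y³, x²y and xy².
    have := add_mem (add_mem
      (Ideal.mul_mem_left _ (r * (1 + b * y + b' * y ^ 2 + s * y ^ 3)) h30)
      (Ideal.mul_mem_left _ (s * (1 + a * x + a' * x ^ 2)) h03))
      (add_mem (Ideal.mul_mem_left _ (a' * b + a' * b' * y) h21) (Ideal.mul_mem_left _ (a * b') h12))
    convert this using 1
    ring

/-- The unit `1 + s t` of `ℂ⟦t⟧`. -/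
noncomputable def arcUnit (s : ℂ) : (PowerSeries ℂ)ˣ :=
  (show IsUnit (1 + PowerSeries.C s * PowerSeries.X) by
    rw [PowerSeries.isUnit_iff_constantCoeff]; simp).unit

theorem coe_arcUnit (s : ℂ) : (arcUnit s : PowerSeries ℂ) = 1 + PowerSeries.C s * PowerSeries.X :=
  rfl

/-- The restriction of Laurent polynomials to the arc `u_i = 1 + s_i t`. -/
noncomputable def arc {k : ℕ} (s : Fin k → ℂ) : Laurent k →ₐ[ℂ] PowerSeries ℂ :=
  AddMonoidAlgebra.lift ℂ (PowerSeries ℂ) (Fin k → ℤ) <| (Units.coeHom _).comp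
    { toFun p := ∏ i, arcUnit (s i) ^ (p.toAdd i)
      map_one' := by simp
      map_mul' p q := by simp [zpow_add, Finset.prod_mul_distrib] }

theorem arc_coord {k : ℕ} (s : Fin k → ℂ) (i : Fin k) :
    arc s (coord i) = PowerSeries.C (s i) * PowerSeries.X := by
  classical
  rw [coord, map_sub, map_one, arc, AddMonoidAlgebra.lift_single]
  simp only [MonoidHom.coe_comp, MonoidHom.coe_mk, OneHom.coe_mk, Function.comp_apply, toAdd_ofAdd,
    one_smul]
  rw [Finset.prod_eq_single i (fun j _ h => by simp [h]) (by simp)]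
  simp [coe_arcUnit]

/-- Arcs through the unit point bound orders of vanishing from above: each generator of the maximal
ideal restricts to a multiple of the parameter t. -/
theorem arc_dvd_of_mem {k : ℕ} (s : Fin k → ℂ) (m : ℕ) {g : Laurent k} (hg : g ∈ maxIdeal k ^ m) :
    PowerSeries.X ^ m ∣ arc s g := by
  have h1 : maxIdeal k ≤ (Ideal.span {(PowerSeries.X : PowerSeries ℂ)}).comap (arc s) := by
    rw [maxIdeal, Ideal.span_le]
    rintro _ ⟨i, rfl⟩
    rw [SetLike.mem_coe, Ideal.mem_comap, Ideal.mem_span_singleton, arc_coord]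
    exact dvd_mul_left _ _
  have h2 := Ideal.le_comap_pow (arc s) m (Ideal.pow_right_mono h1 m hg)
  rwa [Ideal.mem_comap, Ideal.span_singleton_pow, Ideal.mem_span_singleton] at h2

end Laurent

/-! ### Functions on the charts of the blow-up -/

/-- Fractions `f` with `f z ^ N ∈ F N` for some `N`, where `F` is a multiplicative filtration. -/
def reesLocalization {K : Type*} [Field K] [Algebra ℂ K] (F : ℕ → Submodule ℂ K) (z : K)
    (h0 : 1 ∈ F 0) (hm : ∀ m n a b, a ∈ F m → b ∈ F n → a * b ∈ F (m + n)) (hz : z ∈ F 1) :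
    Subalgebra ℂ K where
  carrier := {f | ∃ N, f * z ^ N ∈ F N}
  mul_mem' := by
    rintro a b ⟨M, hM⟩ ⟨N, hN⟩
    refine ⟨M + N, ?_⟩
    convert hm _ _ _ _ hM hN using 1
    ring
  add_mem' := by
    rintro a b ⟨M, hM⟩ ⟨N, hN⟩
    have hzN : ∀ N, z ^ N ∈ F N := fun N => by
      induction N with
      | zero => simpa using h0
      | succ n ih => exact pow_succ z n ▸ hm _ _ _ _ ih hz
    refine ⟨M + N, ?_⟩
    convert add_mem (hm _ _ _ _ hM (hzN N)) (add_comm N M ▸ hm _ _ _ _ hN (hzN M)) using 1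
    ring
  algebraMap_mem' r := ⟨0, by
    rw [pow_zero, mul_one, Algebra.algebraMap_eq_smul_one]
    exact Submodule.smul_mem _ r h0⟩

namespace Laurent

variable {k : ℕ}

/-- The inclusion of the Laurent polynomials in the field of rational functions. -/
noncomputable def toField (k : ℕ) : Laurent k →ₐ[ℂ] TorusField k :=
  IsScalarTower.toAlgHom ℂ (Laurent k) (TorusField k)

theorem toField_injective : Function.Injective (toField k) :=
  IsFractionRing.injective (Laurent k) (TorusField k)

theorem toField_single (p : Fin k → ℤ) : toField k (AddMonoidAlgebra.single p 1) = chi p := rfl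

theorem toField_single' (p : Fin k → ℤ) (c : ℂ) :
    toField k (AddMonoidAlgebra.single p c) = c • chi p := by
  rw [← toField_single, ← map_smul, AddMonoidAlgebra.smul_single, smul_eq_mul, mul_one]

theorem toField_coord (i : Fin k) : toField k (coord i) = loc i := by
  rw [coord, map_sub, map_one, toField_single, loc]

theorem loc_ne_zero (i : Fin k) : loc i ≠ 0 := by
  rw [← toField_coord]
  exact (map_ne_zero_iff _ toField_injective).2 (coord_ne_zero i)

theorem chi_add (p q : Fin k → ℤ) : chi (p + q) = chi p * chi q := by
  rw [← toField_single, single_add, map_mul, toField_single, toField_single]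

theorem chi_zero : chi (0 : Fin k → ℤ) = 1 := by
  rw [← toField_single, ← AddMonoidAlgebra.one_def, map_one]

theorem chi_neg_mul_chi (p : Fin k → ℤ) : chi (-p) * chi p = 1 := by
  rw [← chi_add, neg_add_cancel, chi_zero]

/-- Laurent polynomials which vanish to order at least `N` along the arcs through the unit point
with `i`-th coordinate `1 + t`. -/
noncomputable def arcOrder (i : Fin k) (N : ℕ) : Submodule ℂ (Laurent k) where
  carrier := {g | ∀ s : Fin k → ℂ, s i = 1 → PowerSeries.X ^ N ∣ arc s g}
  add_mem' ha hb s hs := by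
    rw [map_add]
    exact dvd_add (ha s hs) (hb s hs)
  zero_mem' s _ := by simp
  smul_mem' c g hg s hs := by
    rw [map_smul, Algebra.smul_def]
    exact (hg s hs).mul_left _

/-- The generators have this form, χ^p with N = 0 and (u_j - 1)/(u_i - 1) with N = 1, and such
fractions form an algebra because orders add under multiplication. The normalization `s i = 1` makes
u_i - 1 restrict to t itself. -/
theorem exists_of_mem_blowUpChart {i : Fin k} {f : TorusField k} (hf : f ∈ blowUpChart i) :
    ∃ N, ∃ g ∈ arcOrder i N, f * loc i ^ N = toField k g := by
  let A : Subalgebra ℂ (TorusField k) :=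
    reesLocalization (fun N => (arcOrder i N).map (toField k).toLinearMap) (loc i)
      ⟨1, fun s _ => by simp, map_one (toField k)⟩
      (by
        rintro m n _ _ ⟨a, ha, rfl⟩ ⟨b, hb, rfl⟩
        refine ⟨a * b, fun s hs => ?_, map_mul (toField k) a b⟩
        rw [map_mul, pow_add]
        exact mul_dvd_mul (ha s hs) (hb s hs))
      ⟨coord i, fun s _ => by rw [arc_coord, pow_one]; exact dvd_mul_left _ _, toField_coord i⟩
  have hA : blowUpChart i ≤ A := by
    refine Algebra.adjoin_le ?_
    rintro f (⟨p, rfl⟩ | ⟨j, rfl⟩)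
    · exact ⟨0, AddMonoidAlgebra.single p 1, fun s _ => by simp, by
        rw [pow_zero, mul_one]; rfl⟩
    · refine ⟨1, coord j, fun s _ => by rw [arc_coord, pow_one]; exact dvd_mul_left _ _, ?_⟩
      rw [pow_one, div_mul_cancel₀ _ (loc_ne_zero i)]
      exact toField_coord j
  obtain ⟨N, g, hg, e⟩ := hA hf
  exact ⟨N, g, hg, e.symm⟩

/-- After clearing denominators, orders in t are compared along each arc, on which u_i - 1 becomes
t. -/
theorem mem_arcOrder_of_div_mem {i : Fin k} {m : ℕ} {g : Laurent k}
    (h : toField k g / loc i ^ m ∈ blowUpChart i) : g ∈ arcOrder i m := by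
  obtain ⟨N, a, ha, e⟩ := exists_of_mem_blowUpChart h
  intro s hs
  have e' : g * coord i ^ N = a * coord i ^ m := by
    apply toField_injective
    rw [map_mul, map_mul, map_pow, map_pow, toField_coord, ← e]
    field_simp [loc_ne_zero]
  have e2 := congrArg (arc s) e'
  rw [map_mul, map_mul, map_pow, map_pow, arc_coord, hs, map_one, one_mul] at e2
  have h2 : PowerSeries.X ^ m * PowerSeries.X ^ N ∣ arc s g * PowerSeries.X ^ N := by
    rw [e2, mul_comm]
    exact mul_dvd_mul_right (ha s hs) _
  exact (mul_dvd_mul_iff_right (pow_ne_zero _ PowerSeries.X_ne_zero)).1 h2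

theorem toField_mem_blowUpChart (i : Fin k) (g : Laurent k) : toField k g ∈ blowUpChart i := by
  induction g using AddMonoidAlgebra.induction_linear with
  | zero => simp
  | add f g hf hg => rw [map_add]; exact add_mem hf hg
  | single p c =>
    rw [toField_single']
    exact Subalgebra.smul_mem _ (Algebra.subset_adjoin (Set.mem_union_left _ (Set.mem_range_self p))) c

theorem loc_div_mem_blowUpChart (i j : Fin k) : loc j / loc i ∈ blowUpChart i :=
  Algebra.subset_adjoin (Set.mem_union_right _ ⟨j, rfl⟩)

/-- The maximal ideal of the unit point becomes principal on the chart, generated by u_i - 1. -/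
theorem div_mem_blowUpChart {m : ℕ} {g : Laurent k} (hg : g ∈ maxIdeal k ^ m) (i : Fin k) :
    toField k g / loc i ^ m ∈ blowUpChart i := by
  let φ : Laurent k →ₐ[ℂ] blowUpChart i := (toField k).codRestrict _ (toField_mem_blowUpChart i)
  have h1 : maxIdeal k ≤ (Ideal.span {φ (coord i)}).comap φ := by
    rw [maxIdeal, Ideal.span_le]
    rintro _ ⟨j, rfl⟩
    rw [SetLike.mem_coe, Ideal.mem_comap, Ideal.mem_span_singleton]
    refine ⟨⟨_, loc_div_mem_blowUpChart i j⟩, Subtype.ext ?_⟩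
    change toField k (coord j) = toField k (coord i) * (loc j / loc i)
    rw [toField_coord, toField_coord, mul_div_cancel₀ _ (loc_ne_zero i)]
  have h2 := Ideal.le_comap_pow φ m (Ideal.pow_right_mono h1 m hg)
  rw [Ideal.mem_comap, Ideal.span_singleton_pow, Ideal.mem_span_singleton] at h2
  obtain ⟨h, hh⟩ := h2
  have e : toField k g = loc i ^ m * h := by
    have := congrArg Subtype.val hh
    change toField k g = toField k (coord i) ^ m * h at this
    rwa [toField_coord] at this
  rw [e, mul_div_cancel_left₀ _ (pow_ne_zero _ (loc_ne_zero i))]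
  exact h.2

/-- The denominator can be taken to be a power of u_i - 1, and also a power of u_j - 1. These being
coprime, there is no denominator. -/
theorem exists_toField_eq_of_mem_blowUpChart {i j : Fin k} (hij : i ≠ j) {f : TorusField k}
    (hi : f ∈ blowUpChart i) (hj : f ∈ blowUpChart j) : ∃ g, toField k g = f := by
  obtain ⟨N, a, -, ha⟩ := exists_of_mem_blowUpChart hi
  obtain ⟨M, b, -, hb⟩ := exists_of_mem_blowUpChart hj
  obtain ⟨g, rfl⟩ := coord_pow_dvd_of_mul_coord_pow hij M N a b (by
    apply toField_injective
    simp only [map_mul, map_pow, toField_coord, ← ha, ← hb]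
    ring)
  refine ⟨g, ?_⟩
  rw [map_mul, map_pow, toField_coord, mul_comm] at ha
  exact (mul_left_cancel₀ (pow_ne_zero _ (loc_ne_zero i)) ha).symm

/-! ### Global sections of H and of π^*H - mE -/

/-- Regularity on the affine chart at `p` bounds exponents by the half-spaces containing `S - p`. -/
theorem affineChart_le {S : Set (Fin k → ℤ)} {p : Fin k → ℤ} {l : (Fin k → ℤ) →+ ℚ}
    (h : ∀ q ∈ S, l p ≤ l q) : affineChart S p ≤ (halfSpace l).map (toField k) := by
  refine Algebra.adjoin_le ?_
  rintro _ ⟨q, hq, rfl⟩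
  exact ⟨AddMonoidAlgebra.single (q - p) 1,
    single_mem_halfSpace (by rw [map_sub]; exact sub_nonneg.2 (h q hq)) 1, rfl⟩

/-- Deleting the unit point from the chart at `p` inverts χ^(q-p) - 1. As l(q - p) ≥ 0, this allows
no new exponents in a Laurent polynomial. -/
theorem mem_halfSpace_of_mem_awayChart {S : Set (Fin k → ℤ)} {p q : Fin k → ℤ} (hq : q ∈ S)
    (hpq : p ≠ q) {l : (Fin k → ℤ) →+ ℚ} (h : ∀ q ∈ S, l p ≤ l q) {g : Laurent k}
    (hg : toField k g ∈ awayChart S p q) : g ∈ halfSpace l := by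
  set z : Laurent k := AddMonoidAlgebra.single (q - p) 1 - 1 with hz
  have hlz : 0 ≤ l (q - p) := by rw [map_sub]; exact sub_nonneg.2 (h q hq)
  have hv : q - p ≠ 0 := sub_ne_zero.2 hpq.symm
  have hz0 : z ≠ 0 := by
    rw [hz, sub_ne_zero, AddMonoidAlgebra.one_def, Ne,
      AddMonoidAlgebra.single_left_inj one_ne_zero]
    exact hv
  have hfz : toField k z = chi (q - p) - 1 := by rw [hz, map_sub, map_one, toField_single]
  have hfz0 : toField k z ≠ 0 := (map_ne_zero_iff _ toField_injective).2 hz0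
  let B := (halfSpace l).map (toField k)
  let A : Subalgebra ℂ (TorusField k) :=
    reesLocalization (fun _ => Subalgebra.toSubmodule B) (toField k z) B.one_mem
      (fun _ _ _ _ ha hb => B.mul_mem ha hb)
      ⟨z, Subalgebra.sub_mem _ (single_mem_halfSpace hlz 1) (one_mem _), rfl⟩
  have hA : awayChart S p q ≤ A := by
    refine sup_le (fun f hf => ⟨0, ?_⟩) (Algebra.adjoin_le ?_)
    · rw [pow_zero, mul_one]
      exact affineChart_le h hf
    · rintro _ rfl
      refine ⟨1, ?_⟩
      rw [pow_one, hfz, inv_mul_cancel₀ (hfz ▸ hfz0)]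
      exact B.one_mem
  obtain ⟨N, a, ha, e⟩ := hA hg
  have e' : a = g * z ^ N := by
    apply toField_injective
    rw [map_mul, map_pow]
    exact e
  exact mem_halfSpace_of_mul_pow hv hlz N (e' ▸ ha)

theorem chi_neg_mul_toField_mem_affineChart {S : Set (Fin k → ℤ)} (p : Fin k → ℤ) {g : Laurent k}
    (hg : g ∈ AddMonoidAlgebra.supported ℂ ℂ S) : chi (-p) * toField k g ∈ affineChart S p := by
  classical
  rw [← AddMonoidAlgebra.sum_coeff_single g, Finsupp.sum, map_sum, Finset.mul_sum]
  refine sum_mem fun q hq => ?_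
  rw [toField_single', mul_smul_comm, ← chi_add, neg_add_eq_sub]
  exact Subalgebra.smul_mem _ (Algebra.subset_adjoin
    (show chi (q - p) ∈ {f | ∃ q ∈ S, f = chi (q - p)} from ⟨q, hg hq, rfl⟩)) _

/-- An exponent outside Δ is separated from the lattice points by a functional minimal at some
lattice point p, against the half-space condition at p. -/
theorem mem_supported_of_halfSpace {Δ : Set (Fin k → ℚ)} (hΔ : IsFullDimLatticePolytope Δ)
    {g : Laurent k}
    (h : ∀ p ∈ latticePoints Δ, ∀ l : (Fin k → ℤ) →+ ℚ, (∀ q ∈ latticePoints Δ, l p ≤ l q) →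
      AddMonoidAlgebra.single (-p) 1 * g ∈ halfSpace l) :
    g ∈ AddMonoidAlgebra.supported ℂ ℂ (latticePoints Δ) := by
  intro x hx
  by_contra hxS
  obtain ⟨l, p, hp, hl, hlx⟩ := hΔ.exists_separating hxS
  have := h p hp l hl (x - p) (by
    rw [AddMonoidAlgebra.coeff_single_mul_apply, neg_neg, add_sub_cancel, one_mul]
    exact Finsupp.mem_support_iff.1 hx)
  rw [map_sub] at this
  linarith

theorem mem_globalSections_hyperplane {Δ : Set (Fin k → ℚ)} (hΔ : IsFullDimLatticePolytope Δ)
    (hne : (latticePoints Δ).Nonempty) (f : TorusField k) :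
    f ∈ (hyperplane (latticePoints Δ)).globalSections ↔
      ∃ g ∈ AddMonoidAlgebra.supported ℂ ℂ (latticePoints Δ), toField k g = f := by
  simp only [ChartedDivisor.globalSections, Submodule.mem_iInf, Submodule.mem_comap,
    LinearMap.mulLeft_apply, Subalgebra.mem_toSubmodule]
  constructor
  · intro h
    have h' : ∀ p ∈ latticePoints Δ, ∀ l : (Fin k → ℤ) →+ ℚ,
        (∀ q ∈ latticePoints Δ, l p ≤ l q) → ∃ a ∈ halfSpace l, toField k a = chi (-p) * f :=
      fun p hp l hl => affineChart_le hl (h ⟨p, hp⟩)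
    obtain ⟨p, hp⟩ := hne
    -- The functional 0 does not restrict exponents; it only serves to show that `f` is a Laurent
    -- polynomial.
    obtain ⟨a, -, ha⟩ := h' p hp 0 (by simp)
    have hf : toField k (AddMonoidAlgebra.single p 1 * a) = f := by
      rw [map_mul, ha, toField_single, ← mul_assoc, mul_comm (chi p), chi_neg_mul_chi, one_mul]
    refine ⟨_, mem_supported_of_halfSpace hΔ fun q hq l hl => ?_, hf⟩
    obtain ⟨b, hb, hb'⟩ := h' q hq l hl
    convert hb
    apply toField_injective
    rw [map_mul, hf, hb', toField_single]
  · rintro ⟨g, hg, rfl⟩ p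
    exact chi_neg_mul_toField_mem_affineChart _ hg

/-- Two distinct blow-up charts force a Laurent polynomial, and the charts away from the unit point
confine its exponents. What remains is the order condition along E. -/
theorem mem_globalSections_blowUpDivisor {Δ : Set (Fin k → ℚ)} (hΔ : IsFullDimLatticePolytope Δ)
    (hnt : (latticePoints Δ).Nontrivial) {i₀ j₀ : Fin k} (hij : i₀ ≠ j₀) (m : ℕ)
    (f : TorusField k) :
    f ∈ (blowUpDivisor (latticePoints Δ) m).globalSections ↔
      ∃ g ∈ AddMonoidAlgebra.supported ℂ ℂ (latticePoints Δ),
        (∀ i, toField k g / loc i ^ m ∈ blowUpChart i) ∧ toField k g = f := by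
  simp only [ChartedDivisor.globalSections, Submodule.mem_iInf, Submodule.mem_comap,
    LinearMap.mulLeft_apply, Subalgebra.mem_toSubmodule]
  constructor
  · intro h
    have h1 : ∀ i, f / loc i ^ m ∈ blowUpChart i := fun i => by
      rw [div_eq_inv_mul]
      exact h (Sum.inr i)
    have h2 : ∀ i, f ∈ blowUpChart i := fun i => by
      have := mul_mem (h1 i) (toField_mem_blowUpChart i (coord i ^ m))
      rwa [map_pow, toField_coord, div_mul_cancel₀ _ (pow_ne_zero _ (loc_ne_zero i))] at this
    obtain ⟨g, rfl⟩ := exists_toField_eq_of_mem_blowUpChart hij (h2 i₀) (h2 j₀)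
    refine ⟨g, mem_supported_of_halfSpace hΔ fun p hp l hl => ?_, h1, rfl⟩
    -- A second lattice point is needed to have a chart of the complement of the unit point inside
    -- the chart at `p`.
    obtain ⟨q, hq, hqp⟩ := hnt.exists_ne p
    refine mem_halfSpace_of_mem_awayChart hq hqp.symm hl ?_
    rw [map_mul, toField_single]
    exact h (Sum.inl ⟨(⟨p, hp⟩, ⟨q, hq⟩), fun h => hqp (congrArg Subtype.val h).symm⟩)
  · rintro ⟨g, hg, hm, rfl⟩ (⟨⟨p, q⟩, hpq⟩ | i)
    · exact (le_sup_left : affineChart _ _ ≤ awayChart _ _ _)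
        (chi_neg_mul_toField_mem_affineChart _ hg)
    · have := hm i
      rwa [div_eq_inv_mul] at this

end Laurent

/-! ### Orders of vanishing in terms of moments -/

namespace Laurent

theorem arc_sum_localMonomial (s : Fin 2 → ℂ) (c : Fin 6 → ℂ) :
    arc s (∑ j, c j • localMonomial j) = PowerSeries.C (c 0) +
      PowerSeries.C (c 1 * s 0 + c 2 * s 1) * PowerSeries.X +
      PowerSeries.C (c 3 * s 0 ^ 2 + c 4 * (s 0 * s 1) + c 5 * s 1 ^ 2) * PowerSeries.X ^ 2 := by
  simp only [Fin.sum_univ_six, localMonomial, Matrix.cons_val, map_add, map_smul, map_mul, map_pow,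
    map_one, arc_coord, PowerSeries.smul_eq_C_mul]
  ring

theorem coeff_arc_sum_localMonomial (s : Fin 2 → ℂ) (c : Fin 6 → ℂ) :
    PowerSeries.coeff 0 (arc s (∑ j, c j • localMonomial j)) = c 0 ∧
    PowerSeries.coeff 1 (arc s (∑ j, c j • localMonomial j)) = c 1 * s 0 + c 2 * s 1 ∧
    PowerSeries.coeff 2 (arc s (∑ j, c j • localMonomial j)) =
      c 3 * s 0 ^ 2 + c 4 * (s 0 * s 1) + c 5 * s 1 ^ 2 := by
  rw [arc_sum_localMonomial]
  generalize c 1 * s 0 + c 2 * s 1 = a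
  generalize c 3 * s 0 ^ 2 + c 4 * (s 0 * s 1) + c 5 * s 1 ^ 2 = b
  refine ⟨?_, ?_, ?_⟩ <;>
    simp [PowerSeries.coeff_X_pow, PowerSeries.coeff_C]

theorem linear_coeff_eq_zero (i : Fin 2) (a b : ℂ)
    (h : ∀ s : Fin 2 → ℂ, s i = 1 → a * s 0 + b * s 1 = 0) : a = 0 ∧ b = 0 := by
  fin_cases i
  · have h1 := h ![1, 0] rfl
    have h2 := h ![1, 1] rfl
    simp at h1 h2
    subst h1
    simpa using h2
  · have h1 := h ![0, 1] rfl
    have h2 := h ![1, 1] rfl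
    simp at h1 h2
    subst h1
    simpa using h2

theorem quadratic_coeff_eq_zero (i : Fin 2) (a b c : ℂ)
    (h : ∀ s : Fin 2 → ℂ, s i = 1 → a * s 0 ^ 2 + b * (s 0 * s 1) + c * s 1 ^ 2 = 0) :
    a = 0 ∧ b = 0 ∧ c = 0 := by
  fin_cases i
  · have h1 := h ![1, 0] rfl
    have h2 := h ![1, 1] rfl
    have h3 := h ![1, -1] rfl
    simp at h1 h2 h3
    exact ⟨h1, by linear_combination (h2 - h3) / 2, by linear_combination (h2 + h3) / 2 - h1⟩
  · have h1 := h ![0, 1] rfl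
    have h2 := h ![1, 1] rfl
    have h3 := h ![-1, 1] rfl
    simp at h1 h2 h3
    exact ⟨by linear_combination (h2 + h3) / 2 - h1, by linear_combination (h2 - h3) / 2, h1⟩

theorem localMonomial_mem_sq {j : Fin 6} (hj : 3 ≤ j) : localMonomial j ∈ maxIdeal 2 ^ 2 := by
  have hx := coord_mem_maxIdeal (k := 2) 0
  have hy := coord_mem_maxIdeal (k := 2) 1
  fin_cases j
  · exact absurd hj (by decide)
  · exact absurd hj (by decide)
  · exact absurd hj (by decide)
  · exact Ideal.pow_mem_pow hx 2
  · exact pow_two (maxIdeal 2) ▸ Ideal.mul_mem_mul hx hy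
  · exact Ideal.pow_mem_pow hy 2

/-- Modulo the cube of the maximal ideal, `g` is its Taylor polynomial. The differences of
coefficients give a polynomial of degree at most 2 of order 3 on all arcs with `s i = 1`, whose
homogeneous parts therefore vanish. One chart suffices, since a binary form is determined by its
values at `s i = 1`. -/
theorem div_cube_mem_blowUpChart_iff (g : Laurent 2) (a : Fin 6 → ℂ) (i : Fin 2) :
    toField 2 (g - ∑ j, a j • localMonomial j) / loc i ^ 3 ∈ blowUpChart i ↔
      ∀ j, moment (quad j) g = a j := by
  constructor
  · intro h
    have h1 := mem_arcOrder_of_div_mem h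
    have h2 : ∀ s : Fin 2 → ℂ, s i = 1 → PowerSeries.X ^ 3 ∣
        arc s (∑ j, (moment (quad j) g - a j) • localMonomial j) := by
      intro s hs
      have := dvd_sub (h1 s hs) (arc_dvd_of_mem s 3 (sub_taylor_mem g))
      rw [← map_sub] at this
      convert this using 2
      simp only [sub_smul, Finset.sum_sub_distrib]
      abel
    set c := fun j => moment (quad j) g - a j with hc
    have h3 : ∀ s : Fin 2 → ℂ, s i = 1 → ∀ n < 3,
        PowerSeries.coeff n (arc s (∑ j, c j • localMonomial j)) = 0 :=
      fun s hs => PowerSeries.X_pow_dvd_iff.1 (h2 s hs)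
    have h4 : c 0 = 0 :=
      (coeff_arc_sum_localMonomial 1 c).1.symm.trans (h3 1 rfl 0 (by norm_num))
    have h5 := linear_coeff_eq_zero i (c 1) (c 2) fun s hs =>
      (coeff_arc_sum_localMonomial s c).2.1.symm.trans (h3 s hs 1 (by norm_num))
    have h6 := quadratic_coeff_eq_zero i (c 3) (c 4) (c 5) fun s hs =>
      (coeff_arc_sum_localMonomial s c).2.2.symm.trans (h3 s hs 2 (by norm_num))
    intro j
    refine sub_eq_zero.1 (show c j = 0 from ?_)
    fin_cases j
    exacts [h4, h5.1, h5.2, h6.1, h6.2.1, h6.2.2]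
  · intro h
    simp only [← h]
    exact div_mem_blowUpChart (sub_taylor_mem g) i

theorem forall_div_cube_mem_blowUpChart_iff (g : Laurent 2) :
    (∀ i, toField 2 g / loc i ^ 3 ∈ blowUpChart i) ↔ ∀ j, moment (quad j) g = 0 := by
  have key := div_cube_mem_blowUpChart_iff g 0
  simp only [Pi.zero_apply, zero_smul, Finset.sum_const_zero, sub_zero] at key
  exact ⟨fun h => (key 0).1 (h 0), fun h i => (key i).2 h⟩

theorem forall_div_sq_mem_blowUpChart_iff (g : Laurent 2) :
    (∀ i, toField 2 g / loc i ^ 2 ∈ blowUpChart i) ↔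
      moment (quad 0) g = 0 ∧ moment (quad 1) g = 0 ∧ moment (quad 2) g = 0 := by
  constructor
  · intro h
    have h1 := mem_arcOrder_of_div_mem (h 0)
    set c := fun j => moment (quad j) g with hc
    have h3 : ∀ s : Fin 2 → ℂ, s 0 = 1 → ∀ n < 2,
        PowerSeries.coeff n (arc s (∑ j, c j • localMonomial j)) = 0 := by
      intro s hs
      refine PowerSeries.X_pow_dvd_iff.1 ?_
      have := dvd_sub (h1 s hs)
        ((pow_dvd_pow _ (by norm_num)).trans (arc_dvd_of_mem s 3 (sub_taylor_mem g)))
      rw [← map_sub] at this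
      convert this using 2
      abel
    have h4 : c 0 = 0 :=
      (coeff_arc_sum_localMonomial 1 c).1.symm.trans (h3 1 rfl 0 (by norm_num))
    have h5 := linear_coeff_eq_zero 0 (c 1) (c 2) fun s hs =>
      (coeff_arc_sum_localMonomial s c).2.1.symm.trans (h3 s hs 1 (by norm_num))
    exact ⟨h4, h5⟩
  · rintro ⟨h0, h1, h2⟩ i
    refine div_mem_blowUpChart ?_ i
    rw [← sub_add_cancel g (∑ j, moment (quad j) g • localMonomial j)]
    refine add_mem (Ideal.pow_le_pow_right (by norm_num) (sub_taylor_mem g)) (sum_mem fun j _ => ?_)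
    by_cases hj : 3 ≤ j
    · exact Submodule.smul_of_tower_mem _ _ (localMonomial_mem_sq hj)
    · have hm : moment (quad j) g = 0 := by
        fin_cases j
        exacts [h0, h1, h2, absurd le_rfl hj, absurd (by decide) hj, absurd (by decide) hj]
      simp [hm]

end Laurent

/-! ### Binary quadratic forms and restriction to E -/

open MvPolynomial in
/-- The binary quadratic form with given coefficients. -/
noncomputable def binaryForm (a b c : ℂ) : MvPolynomial (Fin 2) ℂ :=
  C a * X 0 ^ 2 + C b * (X 0 * X 1) + C c * X 1 ^ 2

open MvPolynomial in
theorem binaryForm_mem (a b c : ℂ) : binaryForm a b c ∈ homogeneousSubmodule (Fin 2) ℂ 2 := by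
  rw [mem_homogeneousSubmodule]
  have h : ∀ (a : ℂ) (P : MvPolynomial (Fin 2) ℂ), P.IsHomogeneous 2 → (C a * P).IsHomogeneous 2 :=
    fun a P hP => by simpa using (isHomogeneous_C (Fin 2) a).mul hP
  have hX : ∀ i : Fin 2, (X i : MvPolynomial (Fin 2) ℂ).IsHomogeneous 1 := isHomogeneous_X ℂ
  exact ((h a _ ((hX 0).pow 2)).add (h b _ ((hX 0).mul (hX 1)))).add (h c _ ((hX 1).pow 2))

open MvPolynomial in
theorem exists_eq_binaryForm {F : MvPolynomial (Fin 2) ℂ}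
    (hF : F ∈ homogeneousSubmodule (Fin 2) ℂ 2) : ∃ a b c, F = binaryForm a b c := by
  rw [mem_homogeneousSubmodule] at hF
  let W : Submodule ℂ (MvPolynomial (Fin 2) ℂ) := Submodule.span ℂ {X 0 ^ 2, X 0 * X 1, X 1 ^ 2}
  have hW : F ∈ W := by
    rw [F.as_sum]
    refine sum_mem fun d hd => ?_
    have hdeg := hF (mem_support_iff.1 hd)
    have h2 : d 0 + d 1 = 2 := by
      simpa [Finsupp.weight_apply, Finsupp.sum_fintype, Fin.sum_univ_two] using hdeg
    rw [monomial_eq, Finsupp.prod_fintype _ _ (by simp), Fin.prod_univ_two,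
      ← smul_eq_C_mul]
    refine Submodule.smul_mem _ _ (Submodule.subset_span ?_)
    have h0 : d 0 ≤ 2 := by omega
    interval_cases h : d 0
    · simp [show d 1 = 2 by omega]
    · simp [show d 1 = 1 by omega]
    · simp [show d 1 = 0 by omega]
  obtain ⟨a, b, c, h⟩ := Submodule.mem_span_triple.1 hW
  exact ⟨a, b, c, by rw [← h, binaryForm, smul_eq_C_mul, smul_eq_C_mul, smul_eq_C_mul]⟩

open MvPolynomial in
theorem eval_binaryForm (a b c : ℂ) (s : Fin 2 → ℂ) :
    eval s (binaryForm a b c) = a * s 0 ^ 2 + b * (s 0 * s 1) + c * s 1 ^ 2 := by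
  simp [binaryForm]

theorem binaryForm_injective {a b c a' b' c' : ℂ} (h : binaryForm a b c = binaryForm a' b' c') :
    a = a' ∧ b = b' ∧ c = c' := by
  have := quadratic_coeff_eq_zero 0 (a - a') (b - b') (c - c') fun s _ => by
    have := congrArg (MvPolynomial.eval s) h
    rw [eval_binaryForm, eval_binaryForm] at this
    linear_combination this
  simpa [sub_eq_zero] using this

/-- On the i-th chart, restriction to the given form means that `g` minus this form in the local
coordinates is divisible by (u_i - 1)³, i.e. that the form is the quadratic Taylor part of `g`. -/
theorem restrictsTo_binaryForm_iff (g : Laurent 2)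
    (h0 : moment (quad 0) g = 0) (h1 : moment (quad 1) g = 0) (h2 : moment (quad 2) g = 0)
    (a b c : ℂ) :
    RestrictsTo 2 (toField 2 g) (binaryForm a b c) ↔
      moment (quad 3) g = a ∧ moment (quad 4) g = b ∧ moment (quad 5) g = c := by
  have key : ∀ i : Fin 2, (∃ h ∈ blowUpChart i, toField 2 g / loc i ^ 2 -
      MvPolynomial.aeval (fun j => loc j / loc i) (binaryForm a b c) = loc i * h) ↔
      toField 2 (g - ∑ j, (![0, 0, 0, a, b, c] : Fin 6 → ℂ) j • localMonomial j) / loc i ^ 3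
        ∈ blowUpChart i := by
    intro i
    have e : toField 2 g / loc i ^ 2 -
        MvPolynomial.aeval (fun j => loc j / loc i) (binaryForm a b c) = loc i *
        (toField 2 (g - ∑ j, (![0, 0, 0, a, b, c] : Fin 6 → ℂ) j • localMonomial j)
          / loc i ^ 3) := by
      have hi := loc_ne_zero i
      simp only [binaryForm, Fin.sum_univ_six, localMonomial, Matrix.cons_val, map_sub, map_add,
        map_mul, map_pow, AlgHom.commutes, toField_coord, MvPolynomial.aeval_X, MvPolynomial.aeval_C,
        Algebra.smul_def, map_zero, zero_mul, zero_add]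
      field_simp
    constructor
    · rintro ⟨h, hh, e'⟩
      rw [e] at e'
      rwa [mul_left_cancel₀ (loc_ne_zero i) e']
    · intro h
      exact ⟨_, h, e⟩
  rw [RestrictsTo]
  simp only [key, div_cube_mem_blowUpChart_iff]
  constructor
  · intro h
    exact ⟨h 0 3, h 0 4, h 0 5⟩
  · rintro ⟨h3, h4, h5⟩ _ j
    fin_cases j
    exacts [h0, h1, h2, h3, h4, h5]

/-! ### The geometric conditions as conditions on conics -/

namespace Laurent

variable {k n : ℕ} {S : Set (Fin k → ℤ)}

theorem moment_apply (q : (Fin k → ℤ) → ℂ) (g : Laurent k) :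
    moment q g = ∑ p ∈ g.coeff.support, g.coeff p * q p := rfl

theorem finrank_supported (hS : S.Finite) :
    Module.finrank ℂ (AddMonoidAlgebra.supported ℂ ℂ S) = S.ncard := by
  have e : AddMonoidAlgebra.supported ℂ ℂ S = (Finsupp.supported ℂ ℂ S).map
      (AddMonoidAlgebra.coeffLinearEquiv (S := ℂ) (M := Fin k → ℤ) ℂ).symm.toLinearMap :=
    (Submodule.map_equiv_eq_comap_symm
      (AddMonoidAlgebra.coeffLinearEquiv (S := ℂ) (M := Fin k → ℤ) ℂ).symm _).symm
  rw [e, LinearEquiv.finrank_map_eq, (Finsupp.supportedEquivFinsupp S).finrank_eq]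
  have := hS.fintype
  rw [Module.finrank_finsupp_self, Set.ncard_eq_toFinset_card', Set.toFinset_card]

/-- The moments of the Laurent polynomials with exponents in `S`. -/
noncomputable def moments (S : Set (Fin k → ℤ)) (q : Fin n → (Fin k → ℤ) → ℂ) :
    AddMonoidAlgebra.supported ℂ ℂ S →ₗ[ℂ] (Fin n → ℂ) :=
  (LinearMap.pi fun j => moment (q j)).domRestrict _

theorem moments_apply (q : Fin n → (Fin k → ℤ) → ℂ) (g : AddMonoidAlgebra.supported ℂ ℂ S)
    (j : Fin n) : moments S q g j = moment (q j) g := rfl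

theorem single_mem_supported {p : Fin k → ℤ} (hp : p ∈ S) :
    (AddMonoidAlgebra.single p 1 : Laurent k) ∈ AddMonoidAlgebra.supported ℂ ℂ S :=
  Finsupp.single_mem_supported ℂ 1 hp

theorem sum_mul_moment_eq_zero {q : Fin n → (Fin k → ℤ) → ℂ} {a : Fin n → ℂ}
    (ha : ∀ p ∈ S, ∑ j, a j * q j p = 0) {g : Laurent k}
    (hg : g ∈ AddMonoidAlgebra.supported ℂ ℂ S) : ∑ j, a j * moment (q j) g = 0 := by
  simp only [moment_apply, Finset.mul_sum]
  rw [Finset.sum_comm]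
  refine Finset.sum_eq_zero fun p hp => ?_
  rw [← mul_zero (g.coeff p), ← ha p (hg hp), Finset.mul_sum]
  exact Finset.sum_congr rfl fun j _ => by ring

/-- Duality: χ^p is sent to the vector of the values q_j(p), so a functional `a` kills the image iff
Σ a_j q_j vanishes on S. -/
theorem range_moments_eq_top_iff (q : Fin n → (Fin k → ℤ) → ℂ) :
    LinearMap.range (moments S q) = ⊤ ↔
      ∀ a : Fin n → ℂ, (∀ p ∈ S, ∑ j, a j * q j p = 0) → a = 0 := by
  classical
  constructor
  · intro h a ha
    ext i
    obtain ⟨g, hg⟩ := LinearMap.range_eq_top.1 h (Pi.single i 1)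
    have := sum_mul_moment_eq_zero ha g.2
    simpa [← moments_apply, hg, Pi.single_apply] using this
  · intro h
    by_contra hne
    obtain ⟨f, hf, hle⟩ := Submodule.exists_le_ker_of_lt_top _ (lt_top_iff_ne_top.2 hne)
    have hfa : ∀ v : Fin n → ℂ, f v = ∑ j, f (Pi.single j 1) * v j := fun v => by
      conv_lhs => rw [← Finset.univ_sum_single v, map_sum]
      refine Finset.sum_congr rfl fun j _ => ?_
      rw [mul_comm, ← smul_eq_mul, ← map_smul, ← Pi.single_smul, smul_eq_mul, mul_one]
    have h0 := h (fun j => f (Pi.single j 1)) fun p hp => by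
      rw [← hfa]
      have := hle ⟨⟨_, single_mem_supported hp⟩, rfl⟩
      rw [LinearMap.mem_ker] at this
      convert this using 2
      ext j
      rw [moments_apply, moment_single, one_mul]
    exact hf (LinearMap.ext fun v => by rw [hfa]; simp [congrFun h0])

/-- The polynomials of degree at most `2` which vanish on `S` are trivial. -/
def NotOnConic (S : Set (Fin 2 → ℤ)) : Prop :=
  ∀ a : Fin 6 → ℂ, (∀ p ∈ S, ∑ j, a j * quad j p = 0) → a = 0

variable {Δ : Set (Fin 2 → ℚ)}

theorem mem_fundamentalForm_iff (hΔ : IsFullDimLatticePolytope Δ)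
    (hnt : (latticePoints Δ).Nontrivial) (F : MvPolynomial (Fin 2) ℂ) :
    F ∈ fundamentalForm (latticePoints Δ) 2 ↔
      ∃ g ∈ AddMonoidAlgebra.supported ℂ ℂ (latticePoints Δ),
        (moment (quad 0) g = 0 ∧ moment (quad 1) g = 0 ∧ moment (quad 2) g = 0) ∧
        F = binaryForm (moment (quad 3) g) (moment (quad 4) g) (moment (quad 5) g) := by
  have hsec := mem_globalSections_blowUpDivisor hΔ hnt (zero_ne_one (α := Fin 2)) 2
  simp only [forall_div_sq_mem_blowUpChart_iff] at hsec
  constructor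
  · rintro ⟨hF, f, hf, hfF⟩
    obtain ⟨g, hg, hm, rfl⟩ := (hsec f).1 hf
    obtain ⟨a, b, c, rfl⟩ := exists_eq_binaryForm hF
    obtain ⟨rfl, rfl, rfl⟩ := (restrictsTo_binaryForm_iff g hm.1 hm.2.1 hm.2.2 a b c).1 hfF
    exact ⟨g, hg, hm, rfl⟩
  · rintro ⟨g, hg, hm, rfl⟩
    exact ⟨binaryForm_mem _ _ _, toField 2 g, (hsec _).2 ⟨g, hg, hm, rfl⟩,
      (restrictsTo_binaryForm_iff g hm.1 hm.2.1 hm.2.2 _ _ _).2 ⟨rfl, rfl, rfl⟩⟩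

/-- If all quadratic parts occur with zero affine part, a polynomial vanishing on S has no quadratic
part, and then it is zero because S spans the plane. Conversely, surjectivity onto ℂ^6 realizes
every vector (0, 0, 0, a, b, c). -/
theorem isFullDimensionalForm_iff (hΔ : IsFullDimLatticePolytope Δ)
    (hnt : (latticePoints Δ).Nontrivial) :
    IsFullDimensionalForm (latticePoints Δ) 2 ↔ NotOnConic (latticePoints Δ) := by
  constructor
  · intro h a ha
    have key : ∀ x y z : ℂ, a 3 * x + a 4 * y + a 5 * z = 0 := by
      intro x y z
      obtain ⟨g, hg, ⟨h0, h1, h2⟩, hF⟩ := (mem_fundamentalForm_iff hΔ hnt _).1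
        (h.symm ▸ binaryForm_mem x y z)
      obtain ⟨rfl, rfl, rfl⟩ := binaryForm_injective hF
      have := sum_mul_moment_eq_zero ha hg
      simpa [Fin.sum_univ_six, h0, h1, h2] using this
    have h3 : a 3 = 0 := by simpa using key 1 0 0
    have h4 : a 4 = 0 := by simpa using key 0 1 0
    have h5 : a 5 = 0 := by simpa using key 0 0 1
    obtain ⟨h0, h1, h2⟩ := hΔ.line_eq_zero (a 0) (a 1) (a 2) fun p hp => by
      simpa [Fin.sum_univ_six, h3, h4, h5, quad] using ha p hp
    ext j
    fin_cases j
    exacts [h0, h1, h2, h3, h4, h5]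
  · intro h
    refine le_antisymm (fun F hF => hF.1) fun F hF => ?_
    obtain ⟨a, b, c, rfl⟩ := exists_eq_binaryForm hF
    obtain ⟨g, hg⟩ := LinearMap.range_eq_top.1 ((range_moments_eq_top_iff quad).2 h)
      ![0, 0, 0, a, b, c]
    have hj : ∀ j, moment (quad j) g = (![0, 0, 0, a, b, c] : Fin 6 → ℂ) j := fun j => by
      rw [← moments_apply, hg]
    refine (mem_fundamentalForm_iff hΔ hnt _).2 ⟨g, g.2, ⟨hj 0, hj 1, hj 2⟩, ?_⟩
    rw [hj, hj, hj]
    rfl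

/-- By rank-nullity h⁰(π^*H - 3E) is |S| minus the rank of the moment map, and |S| ≥ 6 makes the
expected value |S| - 6. Speciality means rank less than 6. -/
theorem isSpecial_iff (hΔ : IsFullDimLatticePolytope Δ) (hcard : 6 ≤ (latticePoints Δ).ncard) :
    IsSpecial (latticePoints Δ) 3 ↔ ¬ NotOnConic (latticePoints Δ) := by
  set S := latticePoints Δ with hS
  have hfin : S.Finite := Set.finite_of_ncard_pos (by omega)
  have hnt : S.Nontrivial := (Set.one_lt_ncard hfin).1 (by omega)
  have hH : (hyperplane S).globalSections =
      (AddMonoidAlgebra.supported ℂ ℂ S).map (toField 2).toLinearMap := by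
    ext f
    exact mem_globalSections_hyperplane hΔ hnt.nonempty f
  have hB : (blowUpDivisor S 3).globalSections = (LinearMap.ker (moments S quad)).map
      ((toField 2).toLinearMap ∘ₗ (AddMonoidAlgebra.supported ℂ ℂ S).subtype) := by
    ext f
    rw [mem_globalSections_blowUpDivisor hΔ hnt (zero_ne_one (α := Fin 2)) 3]
    simp only [forall_div_cube_mem_blowUpChart_iff]
    constructor
    · rintro ⟨g, hg, hm, rfl⟩
      exact ⟨⟨g, hg⟩, funext hm, rfl⟩
    · rintro ⟨g, hg, rfl⟩
      exact ⟨g, g.2, congrFun hg, rfl⟩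
  have hHd : (hyperplane S).dimLinearSystem = S.ncard - 1 := by
    rw [ChartedDivisor.dimLinearSystem, hH, ← finrank_supported hfin,
      ← (Submodule.equivMapOfInjective _ toField_injective _).finrank_eq]
  have hBd : (blowUpDivisor S 3).dimLinearSystem =
      Module.finrank ℂ (LinearMap.ker (moments S quad)) - 1 := by
    rw [ChartedDivisor.dimLinearSystem, hB, ← (Submodule.equivMapOfInjective _
      (toField_injective.comp Subtype.val_injective) _).finrank_eq]
  have : FiniteDimensional ℂ (AddMonoidAlgebra.supported ℂ ℂ S) :=
    FiniteDimensional.of_finrank_pos (by rw [finrank_supported hfin]; omega)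
  have hrn := (moments S quad).finrank_range_add_finrank_ker
  rw [finrank_supported hfin] at hrn
  have hle : Module.finrank ℂ (LinearMap.range (moments S quad)) ≤ 6 :=
    (Submodule.finrank_le _).trans (by simp)
  have htop : NotOnConic S ↔ Module.finrank ℂ (LinearMap.range (moments S quad)) = 6 := by
    rw [NotOnConic, ← range_moments_eq_top_iff]
    constructor
    · intro h
      rw [h, finrank_top]
      simp
    · intro h
      exact Submodule.eq_top_of_finrank_eq (by simp [h])
  have hchoose : Nat.choose (3 + 2 - 1) 2 = 6 := rfl
  rw [IsSpecial, expectedDim, hHd, hBd, htop, hchoose]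
  omega

/-- Evaluation of the quadratic part at [s : t] is again a moment. It vanishes wherever the three
affine moments do iff the corresponding function on S is an affine function. -/
theorem baseLocus_nonempty_iff (hΔ : IsFullDimLatticePolytope Δ)
    (hnt : (latticePoints Δ).Nontrivial) :
    (baseLocus (latticePoints Δ) 2).Nonempty ↔
      ∃ s t : ℂ, (s ≠ 0 ∨ t ≠ 0) ∧ ∃ α β γ : ℂ, ∀ p ∈ latticePoints Δ,
        (s * p 0 + t * p 1) ^ 2 = α + β * p 0 + γ * p 1 := by
  constructor
  · rintro ⟨x, hx⟩
    set s := x.rep with hs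
    refine ⟨s 0, s 1, ?_, ?_⟩
    · by_contra! h
      refine x.rep_nonzero (funext fun i => ?_)
      fin_cases i
      exacts [h.1, h.2]
    -- With (s, t) the representative of the base point, this function is ((sx + ty)² - s²x -
    -- t²y)/2.
    let q : (Fin 2 → ℤ) → ℂ := fun p =>
      s 0 ^ 2 * quad 3 p + s 0 * s 1 * quad 4 p + s 1 ^ 2 * quad 5 p
    have hq : ∀ g : Laurent 2, moment q g = moment (quad 3) g * s 0 ^ 2 +
        moment (quad 4) g * (s 0 * s 1) + moment (quad 5) g * s 1 ^ 2 := by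
      intro g
      simp only [moment_apply, q, Finset.sum_mul, ← Finset.sum_add_distrib]
      exact Finset.sum_congr rfl fun p _ => by ring
    have hdep : ¬ ∀ a : Fin 4 → ℂ, (∀ p ∈ latticePoints Δ,
        ∑ j, a j * (![quad 0, quad 1, quad 2, q] : Fin 4 → (Fin 2 → ℤ) → ℂ) j p = 0) → a = 0 := by
      rw [← range_moments_eq_top_iff]
      intro h
      obtain ⟨g, hg⟩ := LinearMap.range_eq_top.1 h ![0, 0, 0, 1]
      have h0 : moment (quad 0) g = 0 := congrFun hg 0
      have h1 : moment (quad 1) g = 0 := congrFun hg 1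
      have h2 : moment (quad 2) g = 0 := congrFun hg 2
      have h3 : moment q g = 1 := congrFun hg 3
      have := hx _ ((mem_fundamentalForm_iff hΔ hnt _).2 ⟨g, g.2, ⟨h0, h1, h2⟩, rfl⟩)
      rw [eval_binaryForm, ← hs, ← hq, h3] at this
      exact one_ne_zero this
    push Not at hdep
    obtain ⟨a, ha, hne⟩ := hdep
    simp only [Fin.sum_univ_four, Matrix.cons_val] at ha
    have ha3 : a 3 ≠ 0 := by
      intro h3
      obtain ⟨h0, h1, h2⟩ := hΔ.line_eq_zero (a 0) (a 1) (a 2) fun p hp => by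
        simpa [h3, quad] using ha p hp
      refine hne (funext fun j => ?_)
      fin_cases j
      exacts [h0, h1, h2, h3]
    -- Solving a_0 + a_1 x + a_2 y + a_3 q = 0 for (sx + ty)² = s²x + t²y + 2q.
    refine ⟨-2 * a 0 / a 3, s 0 ^ 2 - 2 * a 1 / a 3, s 1 ^ 2 - 2 * a 2 / a 3, fun p hp => ?_⟩
    have := ha p hp
    simp only [q, quad, Matrix.cons_val] at this
    field_simp
    linear_combination 2 * this
  · rintro ⟨s, t, hst, α, β, γ, h⟩
    have hv : (![s, t] : Fin 2 → ℂ) ≠ 0 := by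
      intro h0
      have h1 := congrFun h0 0
      have h2 := congrFun h0 1
      simp at h1 h2
      tauto
    obtain ⟨u, hu⟩ := Projectivization.exists_smul_eq_mk_rep ℂ _ hv
    refine ⟨Projectivization.mk ℂ _ hv, fun F hF => ?_⟩
    obtain ⟨g, hg, ⟨h0, h1, h2⟩, rfl⟩ := (mem_fundamentalForm_iff hΔ hnt _).1 hF
    -- The coefficients of (sx + ty)² - α - βx - γy in the basis `quad`, by x² = 2 · x(x-1)/2 + x.
    have := sum_mul_moment_eq_zero (q := quad)
      (a := ![-α, s ^ 2 - β, t ^ 2 - γ, 2 * s ^ 2, 2 * (s * t), 2 * t ^ 2]) (fun p hp => by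
        have := h p hp
        simp only [Fin.sum_univ_six, quad, Matrix.cons_val]
        linear_combination this) hg
    simp only [Fin.sum_univ_six, Matrix.cons_val, h0, h1, h2] at this
    rw [← hu, eval_binaryForm]
    simp only [Pi.smul_apply, Matrix.cons_val, Units.smul_def, smul_eq_mul]
    linear_combination (u : ℂ) ^ 2 / 2 * this

end Laurent

/-! ### Convex sets of lattice points and unimodular transformations -/

/-- Sets of lattice points of the plane closed under rational convex combinations. -/
def LatticeConvex (S : Set (ℤ × ℤ)) : Prop :=
  ∀ x₁ y₁ x₂ y₂ x₃ y₃ : ℤ, (x₁, y₁) ∈ S → (x₂, y₂) ∈ S → (x₃, y₃) ∈ S →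
    ∀ i j k x y : ℤ, 0 ≤ i → 0 ≤ j → 0 ≤ k → 0 < i + j + k →
      i * x₁ + j * x₂ + k * x₃ = (i + j + k) * x → i * y₁ + j * y₂ + k * y₃ = (i + j + k) * y →
      (x, y) ∈ S

/-- `S'` is the preimage of `S` under an affine unimodular transformation. -/
def AffineEquivalent (S S' : Set (ℤ × ℤ)) : Prop :=
  ∃ a b c d s t : ℤ, (a * d - b * c = 1 ∨ a * d - b * c = -1) ∧
    ∀ x y, (x, y) ∈ S' ↔ (a * x + b * y + s, c * x + d * y + t) ∈ S

/-- `S` lies on a complex conic, possibly degenerate. -/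
def OnConic (S : Set (ℤ × ℤ)) : Prop :=
  ∃ A B C D E F : ℂ,
    (∃ x y : ℤ, A + B * x + C * y + D * x ^ 2 + E * (x * y) + F * y ^ 2 ≠ 0) ∧
    ∀ x y : ℤ, (x, y) ∈ S → A + B * x + C * y + D * x ^ 2 + E * (x * y) + F * y ^ 2 = 0

/-- Large convex sets of lattice points on a conic which do not lie on a line. -/
structure ConicConfiguration (S : Set (ℤ × ℤ)) : Prop where
  finite : S.Finite
  six_le : 6 ≤ S.ncard
  convex : LatticeConvex S
  conic : OnConic S
  not_line : ∀ a b c : ℤ, (a ≠ 0 ∨ b ≠ 0) → ∃ x y, (x, y) ∈ S ∧ a * x + b * y ≠ c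

theorem AffineEquivalent.trans {S S' S'' : Set (ℤ × ℤ)} (h : AffineEquivalent S S')
    (h' : AffineEquivalent S' S'') : AffineEquivalent S S'' := by
  obtain ⟨a, b, c, d, s, t, hdet, h⟩ := h
  obtain ⟨a', b', c', d', s', t', hdet', h'⟩ := h'
  refine ⟨a * a' + b * c', a * b' + b * d', c * a' + d * c', c * b' + d * d', a * s' + b * t' + s,
    c * s' + d * t' + t, ?_, fun x y => ?_⟩
  · have e : (a * a' + b * c') * (c * b' + d * d') - (a * b' + b * d') * (c * a' + d * c') =
        (a * d - b * c) * (a' * d' - b' * c') := by ring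
    rw [e]
    rcases hdet with hd | hd <;> rcases hdet' with hd' | hd' <;> simp [hd, hd']
  · rw [h', h]
    congr! 2 <;> ring

theorem AffineEquivalent.of_preimage (S : Set (ℤ × ℤ)) (a b c d s t : ℤ)
    (h : a * d - b * c = 1 ∨ a * d - b * c = -1) :
    AffineEquivalent S {p | (a * p.1 + b * p.2 + s, c * p.1 + d * p.2 + t) ∈ S} :=
  ⟨a, b, c, d, s, t, h, fun _ _ => Iff.rfl⟩

theorem exists_affine_preimage {a b c d : ℤ} (h : a * d - b * c = 1 ∨ a * d - b * c = -1)
    (s t x y : ℤ) : ∃ x' y' : ℤ, a * x' + b * y' + s = x ∧ c * x' + d * y' + t = y := by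
  rcases h with h | h
  · exact ⟨d * (x - s) - b * (y - t), a * (y - t) - c * (x - s),
      by linear_combination (x - s) * h, by linear_combination (y - t) * h⟩
  · exact ⟨-(d * (x - s) - b * (y - t)), -(a * (y - t) - c * (x - s)),
      by linear_combination (-(x - s)) * h, by linear_combination (-(y - t)) * h⟩

theorem affine_injective {a b c d : ℤ} (h : a * d - b * c = 1 ∨ a * d - b * c = -1) (s t : ℤ) :
    Function.Injective fun p : ℤ × ℤ => (a * p.1 + b * p.2 + s, c * p.1 + d * p.2 + t) := by
  rintro ⟨x, y⟩ ⟨x', y'⟩ e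
  simp only [Prod.mk.injEq] at e ⊢
  have h0 : a * d - b * c ≠ 0 := by rcases h with h | h <;> simp [h]
  constructor
  · apply mul_left_cancel₀ h0
    linear_combination d * e.1 - b * e.2
  · apply mul_left_cancel₀ h0
    linear_combination a * e.2 - c * e.1

theorem AffineEquivalent.onConic {S S' : Set (ℤ × ℤ)} (h : AffineEquivalent S S')
    (hS : OnConic S) : OnConic S' := by
  obtain ⟨a, b, c, d, s, t, hdet, hSS'⟩ := h
  obtain ⟨A, B, C, D, E, F, ⟨x, y, hxy⟩, hz⟩ := hS
  have key : ∀ x y : ℤ, (A + B * s + C * t + D * s ^ 2 + E * (s * t) + F * t ^ 2) +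
      (B * a + C * c + 2 * D * a * s + E * (a * t + c * s) + 2 * F * c * t) * x +
      (B * b + C * d + 2 * D * b * s + E * (b * t + d * s) + 2 * F * d * t) * y +
      (D * a ^ 2 + E * (a * c) + F * c ^ 2) * x ^ 2 +
      (2 * D * a * b + E * (a * d + b * c) + 2 * F * c * d) * (x * y) +
      (D * b ^ 2 + E * (b * d) + F * d ^ 2) * y ^ 2 =
      A + B * (a * x + b * y + s : ℤ) + C * (c * x + d * y + t : ℤ) +
        D * (a * x + b * y + s : ℤ) ^ 2 +
        E * ((a * x + b * y + s : ℤ) * (c * x + d * y + t : ℤ)) +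
        F * (c * x + d * y + t : ℤ) ^ 2 := by
    intro x y
    push_cast
    ring
  refine ⟨_, _, _, _, _, _, ?_, fun x y h => (key x y).trans (hz _ _ ((hSS' x y).1 h))⟩
  obtain ⟨x', y', rfl, rfl⟩ := exists_affine_preimage hdet s t x y
  exact ⟨x', y', fun h => hxy ((key x' y').symm.trans h)⟩

theorem AffineEquivalent.latticeConvex {S S' : Set (ℤ × ℤ)} (h : AffineEquivalent S S')
    (hS : LatticeConvex S) : LatticeConvex S' := by
  obtain ⟨a, b, c, d, s, t, hdet, hSS'⟩ := h
  intro x₁ y₁ x₂ y₂ x₃ y₃ h₁ h₂ h₃ i j k x y hi hj hk hijk hx hy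
  rw [hSS'] at h₁ h₂ h₃ ⊢
  refine hS _ _ _ _ _ _ h₁ h₂ h₃ i j k _ _ hi hj hk hijk ?_ ?_
  · linear_combination a * hx + b * hy
  · linear_combination c * hx + d * hy

theorem AffineEquivalent.eq_image {S S' : Set (ℤ × ℤ)} {a b c d s t : ℤ}
    (hdet : a * d - b * c = 1 ∨ a * d - b * c = -1)
    (h : ∀ x y, (x, y) ∈ S' ↔ (a * x + b * y + s, c * x + d * y + t) ∈ S) :
    S = (fun p : ℤ × ℤ => (a * p.1 + b * p.2 + s, c * p.1 + d * p.2 + t)) '' S' := by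
  ext ⟨x, y⟩
  constructor
  · intro hxy
    obtain ⟨x', y', rfl, rfl⟩ := exists_affine_preimage hdet s t x y
    exact ⟨(x', y'), (h x' y').2 hxy, rfl⟩
  · rintro ⟨⟨x', y'⟩, hp, e⟩
    exact e ▸ (h x' y').1 hp

theorem AffineEquivalent.conicConfiguration {S S' : Set (ℤ × ℤ)} (h : AffineEquivalent S S')
    (hS : ConicConfiguration S) : ConicConfiguration S' := by
  refine ⟨?_, ?_, h.latticeConvex hS.convex, h.onConic hS.conic, ?_⟩
  · obtain ⟨a, b, c, d, s, t, hdet, hSS'⟩ := h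
    have := hS.finite
    rw [AffineEquivalent.eq_image hdet hSS'] at this
    exact this.of_finite_image (affine_injective hdet s t).injOn
  · obtain ⟨a, b, c, d, s, t, hdet, hSS'⟩ := h
    have := hS.six_le
    rwa [AffineEquivalent.eq_image hdet hSS',
      Set.ncard_image_of_injective _ (affine_injective hdet s t)] at this
  · obtain ⟨a, b, c, d, s, t, hdet, hSS'⟩ := h
    intro l m n hlm
    obtain ⟨x, y, hxy, hne⟩ := hS.not_line (l * d - m * c) (m * a - l * b)
      ((a * d - b * c) * n + (l * d - m * c) * s + (m * a - l * b) * t) (by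
        by_contra! h0
        have h1 : (a * d - b * c) * l = 0 := by linear_combination a * h0.1 + c * h0.2
        have h2 : (a * d - b * c) * m = 0 := by linear_combination b * h0.1 + d * h0.2
        rcases hdet with hd | hd <;> rw [hd] at h1 h2 <;> omega)
    obtain ⟨x', y', rfl, rfl⟩ := exists_affine_preimage hdet s t x y
    refine ⟨x', y', (hSS' _ _).2 hxy, fun e => hne ?_⟩
    linear_combination (a * d - b * c) * e

/-- Four equally spaced points of `S` on a line, consecutive among its lattice points. -/
def HasFourCollinear (S : Set (ℤ × ℤ)) : Prop :=
  ∃ x y u v : ℤ, IsCoprime u v ∧ (x, y) ∈ S ∧ (x + 3 * u, y + 3 * v) ∈ S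

theorem AffineEquivalent.hasFourCollinear {S S' : Set (ℤ × ℤ)} (h : AffineEquivalent S S')
    (hS' : HasFourCollinear S') : HasFourCollinear S := by
  obtain ⟨a, b, c, d, s, t, hdet, hSS'⟩ := h
  obtain ⟨x, y, u, v, ⟨m, n, hmn⟩, h₁, h₂⟩ := hS'
  refine ⟨a * x + b * y + s, c * x + d * y + t, a * u + b * v, c * u + d * v, ?_,
    (hSS' x y).1 h₁, ?_⟩
  · rcases hdet with hd | hd
    · exact ⟨d * m - c * n, a * n - b * m, by linear_combination (m * u + n * v) * hd + hmn⟩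
    · exact ⟨-(d * m - c * n), -(a * n - b * m),
        by linear_combination -(m * u + n * v) * hd + hmn⟩
  · convert (hSS' _ _).1 h₂ using 2 <;> ring

/-- The points of a convex set between two of its points on a line. -/
theorem LatticeConvex.mem_of_between {S : Set (ℤ × ℤ)} (hS : LatticeConvex S) {x y u v m n k : ℤ}
    (hm : (x + m * u, y + m * v) ∈ S) (hn : (x + n * u, y + n * v) ∈ S) (hmk : m ≤ k)
    (hkn : k ≤ n) : (x + k * u, y + k * v) ∈ S := by
  rcases hmk.eq_or_lt with rfl | hlt
  · exact hm
  · exact hS _ _ _ _ _ _ hm hn hn (n - k) (k - m) 0 _ _ (by omega) (by omega) le_rfl (by omega)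
      (by ring) (by ring)

theorem LatticeConvex.mem_row {S : Set (ℤ × ℤ)} (hS : LatticeConvex S) {y m n k : ℤ}
    (hm : (m, y) ∈ S) (hn : (n, y) ∈ S) (hmk : m ≤ k) (hkn : k ≤ n) : (k, y) ∈ S := by
  simpa using hS.mem_of_between (x := 0) (y := y) (u := 1) (v := 0) (by simpa using hm)
    (by simpa using hn) hmk hkn

/-- The inequalities describe the slice at height j of the triangle with the three given vertices.
The weights are barycentric coordinates multiplied by nh, and the sign σ treats both sides of the
axis at once. -/
theorem LatticeConvex.mem_slice {S : Set (ℤ × ℤ)} (hS : LatticeConvex S) {n e h σ j x : ℤ}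
    (hn : 0 < n) (hh : 0 < h) (h0 : (0, 0) ∈ S) (h1 : (n, 0) ∈ S) (h2 : (e, σ * h) ∈ S)
    (hj : 0 ≤ j) (hx : j * e ≤ h * x) (hx' : h * x ≤ j * e + n * (h - j)) : (x, σ * j) ∈ S := by
  have hnh := mul_pos hn hh
  refine hS _ _ _ _ _ _ h2 h1 h0 (n * j) (h * x - j * e) (j * e + n * (h - j) - h * x) _ _
    (by positivity) (by omega) (by omega) (by linarith) (by ring) (by ring)

theorem exists_dvd_of_coprime {u v x y : ℤ} (huv : IsCoprime u v) (h : u * y = v * x) :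
    ∃ m, x = m * u ∧ y = m * v := by
  obtain ⟨a, b, hab⟩ := huv
  exact ⟨a * x + b * y, by linear_combination -x * hab - b * h,
    by linear_combination -y * hab + a * h⟩

theorem exists_primitive {x y : ℤ} (h : x ≠ 0 ∨ y ≠ 0) :
    ∃ n u v : ℤ, 0 < n ∧ IsCoprime u v ∧ x = n * u ∧ y = n * v ∧ n = Int.gcd x y := by
  have hpos : 0 < Int.gcd x y := Int.gcd_pos_iff.2 h
  obtain ⟨u, v, huv, hx, hy⟩ := Int.exists_gcd_one hpos
  exact ⟨Int.gcd x y, u, v, by exact_mod_cast hpos, Int.isCoprime_iff_gcd_eq_one.2 huv,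
    by rw [mul_comm]; exact hx, by rw [mul_comm]; exact hy, rfl⟩

/-- In steps of a primitive vector the points have four distinct integral positions, so two of them
are at least 3 apart, and convexity fills in the points between. -/
theorem LatticeConvex.hasFourCollinear {S : Set (ℤ × ℤ)} (hS : LatticeConvex S)
    {x₁ y₁ x₂ y₂ x₃ y₃ x₄ y₄ : ℤ} (h₁ : (x₁, y₁) ∈ S) (h₂ : (x₂, y₂) ∈ S) (h₃ : (x₃, y₃) ∈ S)
    (h₄ : (x₄, y₄) ∈ S) (h₁₂ : (x₁, y₁) ≠ (x₂, y₂)) (h₁₃ : (x₁, y₁) ≠ (x₃, y₃))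
    (h₁₄ : (x₁, y₁) ≠ (x₄, y₄)) (h₂₃ : (x₂, y₂) ≠ (x₃, y₃)) (h₂₄ : (x₂, y₂) ≠ (x₄, y₄))
    (h₃₄ : (x₃, y₃) ≠ (x₄, y₄)) (hd₃ : (x₂ - x₁) * (y₃ - y₁) = (y₂ - y₁) * (x₃ - x₁))
    (hd₄ : (x₂ - x₁) * (y₄ - y₁) = (y₂ - y₁) * (x₄ - x₁)) : HasFourCollinear S := by
  obtain ⟨n, u, v, hn, huv, hx, hy, -⟩ := exists_primitive (x := x₂ - x₁) (y := y₂ - y₁) (by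
    by_contra! h
    exact h₁₂ (by ext <;> simp <;> omega))
  rw [hx, hy, mul_assoc, mul_assoc] at hd₃ hd₄
  obtain ⟨m, hm, hm'⟩ := exists_dvd_of_coprime huv (mul_left_cancel₀ hn.ne' hd₃)
  obtain ⟨k, hk, hk'⟩ := exists_dvd_of_coprime huv (mul_left_cancel₀ hn.ne' hd₄)
  obtain rfl : x₂ = x₁ + n * u := by omega
  obtain rfl : y₂ = y₁ + n * v := by omega
  obtain rfl : x₃ = x₁ + m * u := by omega
  obtain rfl : y₃ = y₁ + m * v := by omega
  obtain rfl : x₄ = x₁ + k * u := by omega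
  obtain rfl : y₄ = y₁ + k * v := by omega
  have h₀ : (x₁ + 0 * u, y₁ + 0 * v) ∈ S := by simpa using h₁
  have key : ∀ p q : ℤ, (x₁ + p * u, y₁ + p * v) ∈ S → (x₁ + q * u, y₁ + q * v) ∈ S → p + 3 ≤ q →
      HasFourCollinear S := by
    intro p q hp hq hpq
    refine ⟨_, _, u, v, huv, hp, ?_⟩
    convert hS.mem_of_between hp hq (show p ≤ p + 3 by omega) hpq using 2 <;> ring
  by_contra hcon
  have hm0 : m ≠ 0 := by rintro rfl; simp at h₁₃
  have hk0 : k ≠ 0 := by rintro rfl; simp at h₁₄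
  have hmn : n ≠ m := by rintro rfl; simp at h₂₃
  have hkn : n ≠ k := by rintro rfl; simp at h₂₄
  have hmk : m ≠ k := by rintro rfl; simp at h₃₄
  have a₁ := mt (key 0 n h₀ h₂) hcon
  have a₂ := mt (key 0 m h₀ h₃) hcon
  have a₃ := mt (key m 0 h₃ h₀) hcon
  have a₄ := mt (key 0 k h₀ h₄) hcon
  have a₅ := mt (key k 0 h₄ h₀) hcon
  have a₆ := mt (key n m h₂ h₃) hcon
  have a₇ := mt (key m n h₃ h₂) hcon
  have a₈ := mt (key n k h₂ h₄) hcon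
  have a₉ := mt (key k n h₄ h₂) hcon
  have b₁ := mt (key m k h₃ h₄) hcon
  have b₂ := mt (key k m h₄ h₃) hcon
  omega

/-- Any two points of `S` off the horizontal axis and a third one are collinear. -/
def OffAxisCollinear (S : Set (ℤ × ℤ)) : Prop :=
  ∀ x₁ y₁ x₂ y₂ x₃ y₃ : ℤ, (x₁, y₁) ∈ S → (x₂, y₂) ∈ S → (x₃, y₃) ∈ S → y₁ ≠ 0 → y₂ ≠ 0 →
    y₃ ≠ 0 → (x₂ - x₁) * (y₃ - y₁) = (y₂ - y₁) * (x₃ - x₁)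

/-- A conic with three points on the horizontal axis contains it. -/
theorem ConicConfiguration.offAxisCollinear {S : Set (ℤ × ℤ)} (hS : ConicConfiguration S)
    (h0 : (0, 0) ∈ S) (h1 : (1, 0) ∈ S) (h2 : (2, 0) ∈ S) : OffAxisCollinear S := by
  obtain ⟨A, B, C, D, E, F, ⟨x, y, hne⟩, hz⟩ := hS.conic
  have e0 := hz _ _ h0
  have e1 := hz _ _ h1
  have e2 := hz _ _ h2
  simp only [Int.cast_zero, Int.cast_one, Int.cast_ofNat] at e0 e1 e2
  have hA : A = 0 := by linear_combination e0
  have hD : D = 0 := by linear_combination (e2 - 2 * e1 + e0) / 2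
  have hB : B = 0 := by linear_combination e1 - hA - hD
  subst hA hB hD
  -- The equation has become y(C + Ex + Fy) = 0, so points off the axis lie on the residual line.
  have hline : ∀ x y : ℤ, (x, y) ∈ S → y ≠ 0 → C + E * x + F * y = 0 := by
    intro x y hxy hy
    have := hz x y hxy
    have hy' : (y : ℂ) ≠ 0 := by exact_mod_cast hy
    apply mul_left_cancel₀ hy'
    linear_combination this
  intro x₁ y₁ x₂ y₂ x₃ y₃ h₁ h₂ h₃ hy₁ hy₂ hy₃
  have l₁ := hline _ _ h₁ hy₁
  have l₂ := hline _ _ h₂ hy₂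
  have l₃ := hline _ _ h₃ hy₃
  by_contra hdet
  have hdet' : ((x₂ - x₁) * (y₃ - y₁) - (y₂ - y₁) * (x₃ - x₁) : ℂ) ≠ 0 := by
    rw [sub_ne_zero]
    exact_mod_cast hdet
  have hE : E = 0 := by
    apply mul_left_cancel₀ hdet'
    linear_combination (y₃ - y₁ : ℂ) * (l₂ - l₁) - (y₂ - y₁ : ℂ) * (l₃ - l₁)
  have hF : F = 0 := by
    apply mul_left_cancel₀ hdet'
    linear_combination (x₂ - x₁ : ℂ) * (l₃ - l₁) - (x₃ - x₁ : ℂ) * (l₂ - l₁)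
  subst hE hF
  have hC : C = 0 := by linear_combination l₁
  subst hC
  exact hne (by ring)

/-- Any two points of `S` at a multiple of a primitive vector can be moved to the axis. -/
theorem exists_affineEquivalent_axis {S : Set (ℤ × ℤ)} {x y u v n : ℤ} (huv : IsCoprime u v)
    (h₁ : (x, y) ∈ S) (h₂ : (x + n * u, y + n * v) ∈ S) :
    ∃ S', AffineEquivalent S S' ∧ (0, 0) ∈ S' ∧ (n, 0) ∈ S' := by
  obtain ⟨a, b, hab⟩ := huv
  -- The columns (u, v) and (-b, a) have determinant au + bv = 1.
  refine ⟨_, AffineEquivalent.of_preimage S u (-b) v a x y (Or.inl (by linear_combination hab)),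
    ?_, ?_⟩
  · simpa using h₁
  · simpa [mul_comm, add_comm] using h₂

/-- Among five lattice points of the plane two are congruent modulo `2`. -/
theorem exists_ne_congruent_mod_two {S : Set (ℤ × ℤ)} (h : 5 ≤ S.ncard) :
    ∃ p ∈ S, ∃ q ∈ S, p ≠ q ∧ (2 : ℤ) ∣ q.1 - p.1 ∧ (2 : ℤ) ∣ q.2 - p.2 := by
  let φ : ℤ × ℤ → ZMod 2 × ZMod 2 := fun p => (p.1, p.2)
  obtain ⟨p, hp, q, hq, hpq, e⟩ := Set.exists_ne_map_eq_of_ncard_lt_of_maps_to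
    (t := Set.univ) (f := φ) (s := S) (by
      rw [Set.ncard_univ, Nat.card_eq_fintype_card]
      exact lt_of_lt_of_le (by decide) h) (fun _ _ => Set.mem_univ _)
  simp only [φ, Prod.mk.injEq] at e
  exact ⟨p, hp, q, hq, hpq, (ZMod.intCast_eq_intCast_iff_dvd_sub _ _ 2).1 e.1,
    (ZMod.intCast_eq_intCast_iff_dvd_sub _ _ 2).1 e.2⟩

/-! ### Bounding the heights over the axis -/

/-- A configuration with points at `(0, 0), …, (3, 0)` has height at most `1`. -/
theorem height_le_one_of_four {S : Set (ℤ × ℤ)} (hS : LatticeConvex S) (hK : OffAxisCollinear S)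
    (h0 : (0, 0) ∈ S) (h3 : (3, 0) ∈ S) {e h σ : ℤ} (hσ : σ = 1 ∨ σ = -1)
    (hp : (e, σ * h) ∈ S) : h ≤ 1 := by
  by_contra! hh
  have hm := Int.emod_nonneg (e + h - 1) (show h ≠ 0 by omega)
  have hm' := Int.emod_lt_of_pos (e + h - 1) (show 0 < h by omega)
  have hq := Int.mul_ediv_add_emod (e + h - 1) h
  -- This is e/h rounded up. For h ≥ 2 the slice at height 1 contains both x and x + 1, and the line
  -- through them misses the apex.
  set x := (e + h - 1) / h
  have hx : (x, σ * 1) ∈ S := hS.mem_slice (by norm_num) (by omega) h0 h3 hp (by norm_num)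
    (by linarith) (by linarith)
  have hx' : (x + 1, σ * 1) ∈ S := hS.mem_slice (by norm_num) (by omega) h0 h3 hp (by norm_num)
    (by linarith) (by linarith)
  have := hK _ _ _ _ _ _ hx hx' hp (by omega) (by omega) (by rcases hσ with rfl | rfl <;> omega)
  rcases hσ with rfl | rfl <;> ring_nf at this <;> omega

/-- Without four collinear points, there are no points at even nonzero height. -/
theorem odd_height_of_not_four {S : Set (ℤ × ℤ)} (hS : ConicConfiguration S)
    (hK : OffAxisCollinear S) (h0 : (0, 0) ∈ S) (h1 : (1, 0) ∈ S) (h2 : (2, 0) ∈ S)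
    (h4 : ¬ HasFourCollinear S) {e h : ℤ} (hp : (e, h) ∈ S) (hh : h ≠ 0) : ¬ (2 : ℤ) ∣ h := by
  rintro ⟨m, rfl⟩
  have hrow : ∀ x, (x, 0) ∈ S → x = 0 ∨ x = 1 ∨ x = 2 := by
    intro x hx
    by_contra hcon
    apply h4
    rcases (show 3 ≤ x ∨ x ≤ -1 by omega) with h | h
    · exact ⟨0, 0, 1, 0, isCoprime_one_left, h0,
        by simpa using hS.convex.mem_row h0 hx (by norm_num) h⟩
    · exact ⟨-1, 0, 1, 0, isCoprime_one_left, hS.convex.mem_row hx h0 h (by norm_num),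
        by simpa using h2⟩
  -- The point `a` of the axis has the parity of `e`, so that its midpoint with the given point is a
  -- lattice point.
  obtain ⟨a, k, ha, hak⟩ : ∃ a k, (a, 0) ∈ S ∧ e = a + 2 * k := by
    rcases Int.even_or_odd' e with ⟨k, hk | hk⟩
    · exact ⟨0, k, h0, by omega⟩
    · exact ⟨1, k, h1, by omega⟩
  have hm0 : m ≠ 0 := by rintro rfl; simp at hh
  have hmid : (a + k, m) ∈ S := hS.convex _ _ _ _ _ _ ha hp hp 1 1 0 _ _ (by norm_num)
    (by norm_num) le_rfl (by norm_num) (by rw [hak]; ring) (by ring)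
  -- The axis carries only three points of S, so a sixth point lies off it. It is on the line of the
  -- midpoint and the given point, which also passes through (a, 0): four collinear points.
  obtain ⟨⟨x, y⟩, hxy, hy, hne₁, hne₂⟩ : ∃ p ∈ S, p.2 ≠ 0 ∧ p ≠ (a + k, m) ∧ p ≠ (e, 2 * m) := by
    by_contra! hcon
    have hsub : S ⊆ ((({(0, 0), (1, 0), (2, 0), (a + k, m), (e, 2 * m)} : Finset (ℤ × ℤ))) :
        Set (ℤ × ℤ)) := by
      rintro ⟨x, y⟩ hxy
      by_cases hy : y = 0
      · subst hy
        rcases hrow x hxy with rfl | rfl | rfl <;> simp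
      · by_cases hne : (x, y) = (a + k, m)
        · simp [hne]
        · simp [hcon _ hxy hy hne]
    have h5 := (Set.ncard_le_ncard hsub (Finset.finite_toSet _)).trans_eq (Set.ncard_coe_finset _)
    have := hS.six_le.trans (h5.trans Finset.card_le_five)
    omega
  have hdet := hK _ _ _ _ _ _ hmid hp hxy hm0 hh hy
  refine h4 (hS.convex.hasFourCollinear ha hmid hp hxy ?_ ?_ ?_ ?_ hne₁.symm hne₂.symm ?_ ?_)
  · simp [hm0.symm]
  · simp [hm0]
  · simp only [ne_eq, Prod.mk.injEq, not_and]
    exact fun _ => Ne.symm hy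
  · simp only [ne_eq, Prod.mk.injEq, not_and]
    omega
  · rw [hak]; ring
  · rw [hak] at hdet
    linear_combination hdet

/-- A height above 1 is odd, hence at least 3. The slice at height 2 then contains the lattice point
whose abscissa is 2e/h rounded up, at a forbidden even height. -/
theorem height_le_one_of_not_four {S : Set (ℤ × ℤ)} (hS : ConicConfiguration S)
    (hK : OffAxisCollinear S) (h0 : (0, 0) ∈ S) (h1 : (1, 0) ∈ S) (h2 : (2, 0) ∈ S)
    (h4 : ¬ HasFourCollinear S) {e h σ : ℤ} (hσ : σ = 1 ∨ σ = -1)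
    (hp : (e, σ * h) ∈ S) : h ≤ 1 := by
  by_contra! hh
  have hodd := odd_height_of_not_four hS hK h0 h1 h2 h4 hp
    (by rcases hσ with rfl | rfl <;> omega)
  have hh3 : 3 ≤ h := by rcases hσ with rfl | rfl <;> omega
  have hm := Int.emod_nonneg (2 * e + h - 1) (show h ≠ 0 by omega)
  have hm' := Int.emod_lt_of_pos (2 * e + h - 1) (show 0 < h by omega)
  have hq := Int.mul_ediv_add_emod (2 * e + h - 1) h
  set x := (2 * e + h - 1) / h
  have hx : (x, σ * 2) ∈ S := hS.convex.mem_slice (by norm_num) (by omega) h0 h2 hp (by norm_num)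
    (by linarith) (by linarith)
  exact odd_height_of_not_four hS hK h0 h1 h2 h4 hx (by omega) (dvd_mul_left _ _)

/-- Normal position: three points on the axis, all heights at most `1` in absolute value. -/
structure StripConfiguration (S : Set (ℤ × ℤ)) : Prop extends ConicConfiguration S where
  zero_mem : (0, 0) ∈ S
  two_mem : (2, 0) ∈ S
  height : ∀ x y, (x, y) ∈ S → -1 ≤ y ∧ y ≤ 1
  collinear : OffAxisCollinear S

/-- The axis is a line with four points of S if there is one. Otherwise it joins two points
congruent modulo 2, whose difference is an even multiple of a primitive vector, so that three
consecutive points still lie on it. -/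
theorem ConicConfiguration.exists_strip {S : Set (ℤ × ℤ)} (hS : ConicConfiguration S) :
    ∃ S', AffineEquivalent S S' ∧ StripConfiguration S' := by
  by_cases h4 : HasFourCollinear S
  · obtain ⟨x, y, u, v, huv, hp, hq⟩ := h4
    obtain ⟨S', hSS', h0, h3⟩ := exists_affineEquivalent_axis huv hp hq
    have hS' := hSS'.conicConfiguration hS
    have h1 : (1, 0) ∈ S' := hS'.convex.mem_row h0 h3 (by norm_num) (by norm_num)
    have h2 : (2, 0) ∈ S' := hS'.convex.mem_row h0 h3 (by norm_num) (by norm_num)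
    have hK := hS'.offAxisCollinear h0 h1 h2
    refine ⟨S', hSS', hS', h0, h2, fun x y hxy => ?_, hK⟩
    have b1 := height_le_one_of_four hS'.convex hK h0 h3 (h := y) (Or.inl rfl)
      (by simpa using hxy)
    have b2 := height_le_one_of_four hS'.convex hK h0 h3 (h := -y) (Or.inr rfl)
      (by simpa using hxy)
    omega
  · obtain ⟨⟨x, y⟩, hp, ⟨x', y'⟩, hq, hpq, hx, hy⟩ :=
      exists_ne_congruent_mod_two (by linarith [hS.six_le])
    obtain ⟨n, u, v, hn, huv, ex, ey, hgcd⟩ := exists_primitive (x := x' - x) (y := y' - y) (by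
      by_contra! h
      exact hpq (by ext <;> simp <;> omega))
    have h2n : (2 : ℤ) ∣ n := by
      rw [hgcd]
      exact Int.dvd_coe_gcd hx hy
    obtain ⟨S', hSS', h0, hn'⟩ := exists_affineEquivalent_axis huv hp (n := n)
      (by rw [← ex, ← ey]; simpa using hq)
    have hS' := hSS'.conicConfiguration hS
    have h1 : (1, 0) ∈ S' := hS'.convex.mem_row h0 hn' (by norm_num) (by omega)
    have h2 : (2, 0) ∈ S' := hS'.convex.mem_row h0 hn' (by norm_num) (by omega)
    have hK := hS'.offAxisCollinear h0 h1 h2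
    have h4' : ¬ HasFourCollinear S' := mt hSS'.hasFourCollinear h4
    refine ⟨S', hSS', hS', h0, h2, fun x y hxy => ?_, hK⟩
    have b1 := height_le_one_of_not_four hS' hK h0 h1 h2 h4' (h := y) (Or.inl rfl)
      (by simpa using hxy)
    have b2 := height_le_one_of_not_four hS' hK h0 h1 h2 h4' (h := -y) (Or.inr rfl)
      (by simpa using hxy)
    omega

/-! ### Reduction to the standard configurations -/

/-- The lattice points of the standard polygon of type (i). -/
def TrapezoidPoints (S : Set (ℤ × ℤ)) : Prop :=
  ∃ a b : ℤ, 1 ≤ a ∧ a ≤ b ∧ 4 ≤ a + b ∧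
    ∀ x y, (x, y) ∈ S ↔ y = 0 ∧ 0 ≤ x ∧ x ≤ b ∨ y = 1 ∧ 0 ≤ x ∧ x ≤ a

/-- The lattice points of the standard polygon of type (ii). -/
def TrianglePoints (S : Set (ℤ × ℤ)) : Prop :=
  ∃ a : ℤ, 4 ≤ a ∧ ∀ x y, (x, y) ∈ S ↔ y = 0 ∧ 0 ≤ x ∧ x ≤ a ∨ y = 1 ∧ x = 0

/-- The lattice points of the standard polygons of type (iii) for `δ = 0`, of type (iv) for
`δ = -1`. -/
def KitePoints (δ : ℤ) (S : Set (ℤ × ℤ)) : Prop :=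
  ∃ a b : ℤ, 1 ≤ a ∧ 0 ≤ b ∧ 3 ≤ a + b ∧
    ∀ x y, (x, y) ∈ S ↔ y = 0 ∧ -b ≤ x ∧ x ≤ a ∨ y = 1 ∧ x = 0 ∨ y = -1 ∧ x = δ

theorem LatticeConvex.exists_row_eq {S : Set (ℤ × ℤ)} (hS : LatticeConvex S) (hfin : S.Finite)
    {x₀ y : ℤ} (h : (x₀, y) ∈ S) : ∃ l r : ℤ, l ≤ r ∧ ∀ x, (x, y) ∈ S ↔ l ≤ x ∧ x ≤ r := by
  have hrow : {x : ℤ | (x, y) ∈ S}.Finite :=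
    hfin.preimage (f := fun x : ℤ => (x, y)) fun a _ b _ e => (Prod.mk.inj e).1
  obtain ⟨l, hl, hl'⟩ := Set.exists_min_image _ id hrow ⟨x₀, h⟩
  obtain ⟨r, hr, hr'⟩ := Set.exists_max_image _ id hrow ⟨x₀, h⟩
  exact ⟨l, r, hl' r hr, fun x => ⟨fun hx => ⟨hl' x hx, hr' x hx⟩,
    fun hx => hS.mem_row hl hr hx.1 hx.2⟩⟩

/-- Together with |S| ≥ 6 this bound yields 4 ≤ a + b. -/
theorem ncard_le_of_rows {S : Set (ℤ × ℤ)} {l r l' r' : ℤ} (hl : l ≤ r) (hl' : l' ≤ r')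
    (h : ∀ x y, (x, y) ∈ S → y = 0 ∧ l ≤ x ∧ x ≤ r ∨ y = 1 ∧ l' ≤ x ∧ x ≤ r') :
    (S.ncard : ℤ) ≤ (r - l + 1) + (r' - l' + 1) := by
  have hsub : S ⊆ ((Finset.Icc l r ×ˢ {0} ∪ Finset.Icc l' r' ×ˢ {1} : Finset (ℤ × ℤ)) :
      Set (ℤ × ℤ)) := by
    rintro ⟨x, y⟩ hxy
    have := h x y hxy
    simp
    omega
  have h1 := (Set.ncard_le_ncard hsub (Finset.finite_toSet _)).trans_eq (Set.ncard_coe_finset _)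
  have h2 := h1.trans (Finset.card_union_le _ _)
  simp only [Finset.card_product, Int.card_Icc, Finset.card_singleton, mul_one] at h2
  omega

theorem ncard_le_of_row_add_two {S : Set (ℤ × ℤ)} {l r : ℤ} (hl : l ≤ r) (p q : ℤ × ℤ)
    (h : ∀ x y, (x, y) ∈ S → y = 0 ∧ l ≤ x ∧ x ≤ r ∨ (x, y) = p ∨ (x, y) = q) :
    (S.ncard : ℤ) ≤ (r - l + 1) + 2 := by
  have hsub : S ⊆ ((Finset.Icc l r ×ˢ {0} ∪ {p, q} : Finset (ℤ × ℤ)) : Set (ℤ × ℤ)) := by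
    rintro ⟨x, y⟩ hxy
    have := h x y hxy
    simp
    tauto
  have h1 := (Set.ncard_le_ncard hsub (Finset.finite_toSet _)).trans_eq (Set.ncard_coe_finset _)
  have h2 := h1.trans ((Finset.card_union_le _ _).trans
    (Nat.add_le_add_left Finset.card_le_two _))
  simp only [Finset.card_product, Int.card_Icc, Finset.card_singleton, mul_one] at h2
  omega

/-- Both rows are intervals. An integral shear aligns their left ends, and a reflection puts the
longer one on the axis. -/
theorem exists_standard_of_nonneg {S : Set (ℤ × ℤ)} (hS : ConicConfiguration S)
    (h0 : (0, 0) ∈ S) (h2 : (2, 0) ∈ S) (hy : ∀ x y, (x, y) ∈ S → y = 0 ∨ y = 1) :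
    ∃ S', AffineEquivalent S S' ∧ (TrapezoidPoints S' ∨ TrianglePoints S') := by
  obtain ⟨x₁, y₁, h₁, hne⟩ := hS.not_line 0 1 0 (by simp)
  obtain rfl : y₁ = 1 := by
    have := hy _ _ h₁
    omega
  obtain ⟨l, r, hlr, hrow⟩ := hS.convex.exists_row_eq hS.finite h0
  obtain ⟨l', r', hlr', hrow'⟩ := hS.convex.exists_row_eq hS.finite h₁
  have hcases : ∀ x y, (x, y) ∈ S ↔ y = 0 ∧ l ≤ x ∧ x ≤ r ∨ y = 1 ∧ l' ≤ x ∧ x ≤ r' := by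
    intro x y
    constructor
    · intro h
      rcases hy _ _ h with rfl | rfl
      · exact Or.inl ⟨rfl, (hrow x).1 h⟩
      · exact Or.inr ⟨rfl, (hrow' x).1 h⟩
    · rintro (⟨rfl, h⟩ | ⟨rfl, h⟩)
      · exact (hrow x).2 h
      · exact (hrow' x).2 h
  have hcard := ncard_le_of_rows hlr hlr' fun x y => (hcases x y).1
  have h6 := hS.six_le
  have ha := (hrow 0).1 h0
  have hb := (hrow 2).1 h2
  by_cases hle : r' - l' ≤ r - l
  · refine ⟨_, AffineEquivalent.of_preimage S 1 (l' - l) 0 1 l 0 (by simp), ?_⟩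
    by_cases hz : r' = l'
    · refine Or.inr ⟨r - l, by omega, fun x y => ?_⟩
      simp only [Set.mem_ofPred_eq, hcases]
      constructor
      · rintro (⟨h, h'⟩ | ⟨h, h'⟩)
        · obtain rfl : y = 0 := by omega
          omega
        · obtain rfl : y = 1 := by omega
          omega
      · rintro (⟨rfl, h'⟩ | ⟨rfl, h'⟩) <;> omega
    · refine Or.inl ⟨r' - l', r - l, by omega, by omega, by omega, fun x y => ?_⟩
      simp only [Set.mem_ofPred_eq, hcases]
      constructor
      · rintro (⟨h, h'⟩ | ⟨h, h'⟩)
        · obtain rfl : y = 0 := by omega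
          omega
        · obtain rfl : y = 1 := by omega
          omega
      · rintro (⟨rfl, h'⟩ | ⟨rfl, h'⟩) <;> omega
  · refine ⟨_, AffineEquivalent.of_preimage S 1 (l - l') 0 (-1) l' 1 (by simp), ?_⟩
    refine Or.inl ⟨r - l, r' - l', by omega, by omega, by omega, fun x y => ?_⟩
    simp only [Set.mem_ofPred_eq, hcases]
    constructor
    · rintro (⟨h, h'⟩ | ⟨h, h'⟩)
      · obtain rfl : y = 1 := by omega
        omega
      · obtain rfl : y = 0 := by omega
        omega
    · rintro (⟨rfl, h'⟩ | ⟨rfl, h'⟩) <;> omega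

/-- Two points on one side and one on the other are not collinear, so each side has a single apex.
The segment between the apexes meets the axis at (c + d)/2: an integer leads to δ = 0, a
half-integer to δ = -1. -/
theorem exists_kite {S : Set (ℤ × ℤ)} (hS : StripConfiguration S) {c d : ℤ} (hc : (c, 1) ∈ S)
    (hd : (d, -1) ∈ S) :
    ∃ S', AffineEquivalent S S' ∧ (KitePoints 0 S' ∨ KitePoints (-1) S') := by
  obtain ⟨l, r, hlr, hrow⟩ := hS.convex.exists_row_eq hS.finite hS.zero_mem
  have hcases : ∀ x y, (x, y) ∈ S ↔ y = 0 ∧ l ≤ x ∧ x ≤ r ∨ y = 1 ∧ x = c ∨ y = -1 ∧ x = d := by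
    intro x y
    constructor
    · intro h
      have := hS.height _ _ h
      rcases (show y = 0 ∨ y = 1 ∨ y = -1 by omega) with rfl | rfl | rfl
      · exact Or.inl ⟨rfl, (hrow x).1 h⟩
      · have := hS.collinear _ _ _ _ _ _ hc h hd (by norm_num) (by norm_num) (by norm_num)
        exact Or.inr (Or.inl ⟨rfl, by linarith⟩)
      · have := hS.collinear _ _ _ _ _ _ hd h hc (by norm_num) (by norm_num) (by norm_num)
        exact Or.inr (Or.inr ⟨rfl, by linarith⟩)
    · rintro (⟨rfl, h⟩ | ⟨rfl, rfl⟩ | ⟨rfl, rfl⟩)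
      exacts [(hrow x).2 h, hc, hd]
  have hcard := ncard_le_of_row_add_two hlr (c, 1) (d, -1) fun x y hxy => by
    rcases (hcases x y).1 hxy with h | ⟨rfl, rfl⟩ | ⟨rfl, rfl⟩
    exacts [Or.inl h, Or.inr (Or.inl rfl), Or.inr (Or.inr rfl)]
  have h6 := hS.six_le
  rcases Int.even_or_odd' (c + d) with ⟨m, hm | hm⟩
  · have hmid : (m, 0) ∈ S := hS.convex _ _ _ _ _ _ hc hd hd 1 1 0 _ _ (by norm_num) (by norm_num)
      le_rfl (by norm_num) (by linarith) (by norm_num)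
    have hlm := (hrow m).1 hmid
    -- The midpoint becomes the origin. If it is the right end of the row, a reflection ensures a ≥
    -- 1.
    by_cases hr : m < r
    · refine ⟨_, AffineEquivalent.of_preimage S 1 (c - m) 0 1 m 0 (by simp), Or.inl
        ⟨r - m, m - l, by omega, by omega, by omega, fun x y => ?_⟩⟩
      simp only [Set.mem_ofPred_eq, hcases]
      constructor
      · rintro (⟨h, h'⟩ | ⟨h, h'⟩ | ⟨h, h'⟩)
        · obtain rfl : y = 0 := by omega
          omega
        · obtain rfl : y = 1 := by omega
          omega
        · obtain rfl : y = -1 := by omega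
          omega
      · rintro (⟨rfl, h'⟩ | ⟨rfl, h'⟩ | ⟨rfl, h'⟩) <;> omega
    · refine ⟨_, AffineEquivalent.of_preimage S (-1) (c - m) 0 1 m 0 (by simp), Or.inl
        ⟨m - l, r - m, by omega, by omega, by omega, fun x y => ?_⟩⟩
      simp only [Set.mem_ofPred_eq, hcases]
      constructor
      · rintro (⟨h, h'⟩ | ⟨h, h'⟩ | ⟨h, h'⟩)
        · obtain rfl : y = 0 := by omega
          omega
        · obtain rfl : y = 1 := by omega
          omega
        · obtain rfl : y = -1 := by omega
          omega
      · rintro (⟨rfl, h'⟩ | ⟨rfl, h'⟩ | ⟨rfl, h'⟩) <;> omega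
  -- The crossing point is m + 1/2. If the row lay beyond m + 1, the triangle on its left end and
  -- the apexes would contain (m + 1, 0); likewise on the other side.
  · have hl : l ≤ m + 1 := by
      by_contra! h
      have : (m + 1, 0) ∈ S := hS.convex _ _ _ _ _ _ hc hd ((hrow l).2 ⟨le_rfl, hlr⟩)
        (l - (m + 1)) (l - (m + 1)) 1 _ _ (by omega) (by omega) (by norm_num) (by omega)
        (by linear_combination (l - (m + 1)) * hm) (by ring)
      have := (hrow _).1 this
      omega
    have hr : m ≤ r := by
      by_contra! h
      have : (m, 0) ∈ S := hS.convex _ _ _ _ _ _ hc hd ((hrow r).2 ⟨hlr, le_rfl⟩)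
        (m - r) (m - r) 1 _ _ (by omega) (by omega) (by norm_num) (by omega)
        (by linear_combination (m - r) * hm) (by ring)
      have := (hrow _).1 this
      omega
    -- The origin is m + 1, or m after a reflection; the choice ensures a ≥ 1, using r - l ≥ 3 in
    -- the second case.
    by_cases hr' : m + 2 ≤ r
    · refine ⟨_, AffineEquivalent.of_preimage S 1 (c - (m + 1)) 0 1 (m + 1) 0 (by simp), Or.inr
        ⟨r - (m + 1), m + 1 - l, by omega, by omega, by omega, fun x y => ?_⟩⟩
      simp only [Set.mem_ofPred_eq, hcases]
      constructor
      · rintro (⟨h, h'⟩ | ⟨h, h'⟩ | ⟨h, h'⟩)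
        · obtain rfl : y = 0 := by omega
          omega
        · obtain rfl : y = 1 := by omega
          omega
        · obtain rfl : y = -1 := by omega
          omega
      · rintro (⟨rfl, h'⟩ | ⟨rfl, h'⟩ | ⟨rfl, h'⟩) <;> omega
    · refine ⟨_, AffineEquivalent.of_preimage S (-1) (c - m) 0 1 m 0 (by simp), Or.inr
        ⟨m - l, r - m, by omega, by omega, by omega, fun x y => ?_⟩⟩
      simp only [Set.mem_ofPred_eq, hcases]
      constructor
      · rintro (⟨h, h'⟩ | ⟨h, h'⟩ | ⟨h, h'⟩)
        · obtain rfl : y = 0 := by omega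
          omega
        · obtain rfl : y = 1 := by omega
          omega
        · obtain rfl : y = -1 := by omega
          omega
      · rintro (⟨rfl, h'⟩ | ⟨rfl, h'⟩ | ⟨rfl, h'⟩) <;> omega

/-- Classification of the convex sets of at least six lattice points on a conic. -/
theorem ConicConfiguration.classification {S : Set (ℤ × ℤ)} (hS : ConicConfiguration S) :
    ∃ S', AffineEquivalent S S' ∧
      (TrapezoidPoints S' ∨ TrianglePoints S' ∨ KitePoints 0 S' ∨ KitePoints (-1) S') := by
  obtain ⟨T, hST, hT⟩ := hS.exists_strip
  by_cases hpos : ∃ c, (c, 1) ∈ T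
  · obtain ⟨c, hc⟩ := hpos
    by_cases hneg : ∃ d, (d, -1) ∈ T
    · obtain ⟨d, hd⟩ := hneg
      obtain ⟨S', h, h'⟩ := exists_kite hT hc hd
      exact ⟨S', hST.trans h, by tauto⟩
    · obtain ⟨S', h, h'⟩ := exists_standard_of_nonneg hT.toConicConfiguration hT.zero_mem hT.two_mem
        fun x y hxy => by
          have := hT.height x y hxy
          have : y ≠ -1 := by rintro rfl; exact hneg ⟨x, hxy⟩
          omega
      exact ⟨S', hST.trans h, by tauto⟩
  · have hflip := AffineEquivalent.of_preimage T 1 0 0 (-1) 0 0 (by simp)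
    obtain ⟨S', h, h'⟩ := exists_standard_of_nonneg
      (hflip.conicConfiguration hT.toConicConfiguration) (by simpa using hT.zero_mem)
      (by simpa using hT.two_mem) fun x y hxy => by
        simp only [Set.mem_ofPred_eq, one_mul, zero_mul, add_zero, zero_add] at hxy
        have := hT.height _ _ hxy
        have : -1 * y ≠ 1 := by intro e; exact hpos ⟨x, e ▸ hxy⟩
        omega
    exact ⟨S', (hST.trans hflip).trans h, by tauto⟩

theorem AffineEquivalent.symm {S S' : Set (ℤ × ℤ)} (h : AffineEquivalent S S') :
    AffineEquivalent S' S := by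
  obtain ⟨a, b, c, d, s, t, hdet, h⟩ := h
  rcases hdet with hd | hd
  · refine ⟨d, -b, -c, a, -(d * s - b * t), -(a * t - c * s), Or.inl (by linear_combination hd),
      fun x y => ?_⟩
    rw [h]
    congr! 2
    · linear_combination (s - x) * hd
    · linear_combination (t - y) * hd
  · refine ⟨-d, b, c, -a, d * s - b * t, a * t - c * s, Or.inr (by linear_combination hd),
      fun x y => ?_⟩
    rw [h]
    congr! 2
    · linear_combination (x - s) * hd
    · linear_combination (y - t) * hd

/-! ### Parabolas and pairs of parallel lines -/

/-- `S` lies on a parabola, or on parallel lines. -/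
def OnParabola (S : Set (ℤ × ℤ)) : Prop :=
  ∃ s t : ℂ, (s ≠ 0 ∨ t ≠ 0) ∧ ∃ α β γ : ℂ,
    ∀ x y : ℤ, (x, y) ∈ S → (s * x + t * y) ^ 2 = α + β * x + γ * y

theorem OnParabola.onConic {S : Set (ℤ × ℤ)} (h : OnParabola S) : OnConic S := by
  obtain ⟨s, t, hst, α, β, γ, h⟩ := h
  refine ⟨-α, -β, -γ, s ^ 2, 2 * (s * t), t ^ 2, ?_, fun x y hxy => by
    linear_combination h x y hxy⟩
  by_contra! h0
  have e0 := h0 0 0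
  have e1 := h0 1 0
  have e2 := h0 (-1) 0
  have e3 := h0 0 1
  have e4 := h0 0 (-1)
  push_cast at e0 e1 e2 e3 e4
  -- Second differences along the coordinate axes recover s² and t².
  have hs : s ^ 2 = 0 := by linear_combination (e1 + e2) / 2 - e0
  have ht : t ^ 2 = 0 := by linear_combination (e3 + e4) / 2 - e0
  simp only [ne_eq, OfNat.ofNat_ne_zero, not_false_eq_true, pow_eq_zero_iff] at hs ht
  tauto

theorem AffineEquivalent.onParabola {S S' : Set (ℤ × ℤ)} (h : AffineEquivalent S S')
    (hS : OnParabola S) : OnParabola S' := by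
  obtain ⟨a, b, c, d, u, v, hdet, hSS'⟩ := h
  obtain ⟨s, t, hst, α, β, γ, h⟩ := hS
  refine ⟨s * a + t * c, s * b + t * d, ?_, α + β * u + γ * v - (s * u + t * v) ^ 2,
    β * a + γ * c - 2 * (s * u + t * v) * (s * a + t * c),
    β * b + γ * d - 2 * (s * u + t * v) * (s * b + t * d), fun x y hxy => ?_⟩
  · by_contra! h0
    have hdet' : (a * d - b * c : ℂ) ≠ 0 := by
      have : a * d - b * c ≠ 0 := by rcases hdet with hd | hd <;> simp [hd]
      exact_mod_cast this
    have h1 : s = 0 := by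
      apply mul_left_cancel₀ hdet'
      linear_combination d * h0.1 - c * h0.2
    have h2 : t = 0 := by
      apply mul_left_cancel₀ hdet'
      linear_combination a * h0.2 - b * h0.1
    tauto
  · have := h _ _ ((hSS' x y).1 hxy)
    push_cast at this
    linear_combination this

/-- The second difference along three consecutive points of the axis gives s = 0, and then β = 0.
Now t²y² = α + γy holds at y = -1, 0, 1, which forces t = 0. -/
theorem not_onParabola_of_mem {S : Set (ℤ × ℤ)} {n δ : ℤ} (h0 : (n, 0) ∈ S) (h1 : (n + 1, 0) ∈ S)
    (h2 : (n + 2, 0) ∈ S) (h3 : (0, 1) ∈ S) (h4 : (δ, -1) ∈ S) : ¬ OnParabola S := by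
  rintro ⟨s, t, hst, α, β, γ, h⟩
  have e0 := h _ _ h0
  have e1 := h _ _ h1
  have e2 := h _ _ h2
  have e3 := h _ _ h3
  have e4 := h _ _ h4
  push_cast at e0 e1 e2 e3 e4
  have hs : s ^ 2 = 0 := by linear_combination (e0 + e2) / 2 - e1
  rw [pow_eq_zero_iff two_ne_zero] at hs
  subst hs
  have hβ : β = 0 := by linear_combination e0 - e1
  subst hβ
  have ht : t ^ 2 = 0 := by linear_combination (e3 + e4) / 2 - e0
  rw [pow_eq_zero_iff two_ne_zero] at ht
  tauto

/-! ### From polygons to sets of lattice points -/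

namespace LatticePolytope

/-- The lattice points of a subset of the plane, as pairs of integers. -/
def planarPoints (Δ : Set (Fin 2 → ℚ)) : Set (ℤ × ℤ) := {p | ![p.1, p.2] ∈ latticePoints Δ}

variable {Δ : Set (Fin 2 → ℚ)}

theorem mem_planarPoints {x y : ℤ} : (x, y) ∈ planarPoints Δ ↔ toRat ![x, y] ∈ Δ := Iff.rfl

theorem mem_planarPoints' {p : Fin 2 → ℤ} : (p 0, p 1) ∈ planarPoints Δ ↔ toRat p ∈ Δ := by
  rw [mem_planarPoints, show ![p 0, p 1] = p from by ext i; fin_cases i <;> rfl]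

theorem planarPoints_eq_image :
    planarPoints Δ = (fun p : Fin 2 → ℤ => (p 0, p 1)) '' latticePoints Δ := by
  ext ⟨x, y⟩
  constructor
  · intro h
    exact ⟨![x, y], h, rfl⟩
  · rintro ⟨p, hp, e⟩
    rw [← e]
    exact mem_planarPoints'.2 hp

theorem ncard_planarPoints : (planarPoints Δ).ncard = (latticePoints Δ).ncard := by
  rw [planarPoints_eq_image]
  refine Set.ncard_image_of_injective _ fun p q h => ?_
  simp only [Prod.mk.injEq] at h
  ext i
  fin_cases i
  exacts [h.1, h.2]

theorem latticeConvex_planarPoints (hΔ : Convex ℚ Δ) : LatticeConvex (planarPoints Δ) := by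
  intro x₁ y₁ x₂ y₂ x₃ y₃ h₁ h₂ h₃ i j k x y hi hj hk hpos hx hy
  rw [mem_planarPoints] at *
  have hpos' : (0 : ℚ) < i + j + k := by exact_mod_cast hpos
  have hi' : (0 : ℚ) ≤ i := by exact_mod_cast hi
  have hj' : (0 : ℚ) ≤ j := by exact_mod_cast hj
  have hk' : (0 : ℚ) ≤ k := by exact_mod_cast hk
  have hx' : (i * x₁ + j * x₂ + k * x₃ : ℚ) = (i + j + k) * x := by exact_mod_cast hx
  have hy' : (i * y₁ + j * y₂ + k * y₃ : ℚ) = (i + j + k) * y := by exact_mod_cast hy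
  have := hΔ.sum_mem (t := Finset.univ)
    (w := ![(i : ℚ) / (i + j + k), (j : ℚ) / (i + j + k), (k : ℚ) / (i + j + k)])
    (z := ![toRat ![x₁, y₁], toRat ![x₂, y₂], toRat ![x₃, y₃]])
    (by intro m _; fin_cases m <;> simp <;> positivity)
    (by simp only [Fin.sum_univ_three, Matrix.cons_val]; field_simp)
    (by intro m _; fin_cases m <;> assumption)
  convert this
  ext m
  fin_cases m
  · simp [Fin.sum_univ_three, toRat]
    field_simp
    linear_combination -hx'
  · simp [Fin.sum_univ_three, toRat]
    field_simp
    linear_combination -hy'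

theorem IsFullDimLatticePolytope.convex {k : ℕ} {Δ : Set (Fin k → ℚ)}
    (hΔ : IsFullDimLatticePolytope Δ) : Convex ℚ Δ :=
  hΔ.convexHull_latticePoints ▸ convex_convexHull ..

/-- The two notions differ by the change of basis between x² and x(x-1)/2. A polynomial of degree at
most 2 is zero once it vanishes at (0,0), (±1,0), (0,±1) and (1,1). -/
theorem notOnConic_iff : NotOnConic (latticePoints Δ) ↔ ¬ OnConic (planarPoints Δ) := by
  constructor
  · rintro h ⟨A, B, C, D, E, F, ⟨x, y, hne⟩, hz⟩
    have h0 := h ![A, B + D, C + F, 2 * D, E, 2 * F] fun p hp => by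
      have := hz _ _ (mem_planarPoints'.2 hp)
      simp only [Fin.sum_univ_six, quad, Matrix.cons_val]
      linear_combination this
    have hA : A = 0 := congrFun h0 0
    have hB : B + D = 0 := congrFun h0 1
    have hC : C + F = 0 := congrFun h0 2
    have hD : 2 * D = 0 := congrFun h0 3
    have hE : E = 0 := congrFun h0 4
    have hF : 2 * F = 0 := congrFun h0 5
    apply hne
    linear_combination hA + hB * x + hC * y + hD * (x ^ 2 - x) / 2 + hE * (x * y) +
      hF * (y ^ 2 - y) / 2
  · intro h a ha
    by_contra hne
    refine h ⟨a 0, a 1 - a 3 / 2, a 2 - a 5 / 2, a 3 / 2, a 4, a 5 / 2, ?_, fun x y hxy => ?_⟩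
    · by_contra! h0
      have e0 := h0 0 0
      have e1 := h0 1 0
      have e2 := h0 (-1) 0
      have e3 := h0 0 1
      have e4 := h0 0 (-1)
      have e5 := h0 1 1
      push_cast at e0 e1 e2 e3 e4 e5
      have h0 : a 0 = 0 := by linear_combination e0
      have h1 : a 1 = 0 := by linear_combination e1 - e0
      have h2 : a 2 = 0 := by linear_combination e3 - e0
      have h3 : a 3 = 0 := by linear_combination e1 + e2 - 2 * e0
      have h5 : a 5 = 0 := by linear_combination e3 + e4 - 2 * e0
      have h4 : a 4 = 0 := by linear_combination e5 - e1 - e3 + e0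
      refine hne (funext fun j => ?_)
      fin_cases j
      exacts [h0, h1, h2, h3, h4, h5]
    · have := ha _ hxy
      simp only [Fin.sum_univ_six, quad, Matrix.cons_val] at this
      linear_combination this

theorem conicConfiguration_planarPoints (hΔ : IsFullDimLatticePolytope Δ)
    (hcard : 6 ≤ (latticePoints Δ).ncard) (h : OnConic (planarPoints Δ)) :
    ConicConfiguration (planarPoints Δ) := by
  rw [← ncard_planarPoints] at hcard
  refine ⟨Set.finite_of_ncard_pos (by omega), hcard, latticeConvex_planarPoints hΔ.convex, h, ?_⟩
  intro a b c hab
  by_contra! hcon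
  obtain ⟨-, ha, hb⟩ := hΔ.line_eq_zero (-c) a b fun p hp => by
    have : (a * p 0 + b * p 1 : ℂ) = c := by exact_mod_cast hcon _ _ (mem_planarPoints'.2 hp)
    linear_combination this
  have ha' : a = 0 := by exact_mod_cast ha
  have hb' : b = 0 := by exact_mod_cast hb
  tauto

/-- The affine map of the rational plane given by an integral matrix and translation. -/
def affineMap {k : ℕ} (A : Matrix (Fin k) (Fin k) ℤ) (t : Fin k → ℤ) :
    (Fin k → ℚ) →ᵃ[ℚ] (Fin k → ℚ) where
  toFun x := (A.map (Int.cast : ℤ → ℚ)).mulVec x + toRat t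
  linear := (A.map (Int.cast : ℤ → ℚ)).mulVecLin
  map_vadd' x v := by simp [Matrix.mulVec_add, add_assoc]

theorem affineMap_toRat {k : ℕ} (A : Matrix (Fin k) (Fin k) ℤ) (t p : Fin k → ℤ) :
    affineMap A t (toRat p) = toRat (A.mulVec p + t) := by
  ext i
  change ((A.map (Int.cast : ℤ → ℚ)).mulVec (toRat p) + toRat t) i = _
  simp [toRat, Matrix.mulVec, dotProduct]

/-- Since Δ is the hull of its lattice points, two inclusions suffice: the vertices of the standard
polygon belong to S, and S lies in the polygon. -/
theorem unimodularEquivalent_of_affineEquivalent (hΔ : IsFullDimLatticePolytope Δ)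
    {S : Set (ℤ × ℤ)} (h : AffineEquivalent (planarPoints Δ) S) (N : Set (Fin 2 → ℤ))
    (hN : ∀ p ∈ N, (p 0, p 1) ∈ S)
    (hS : ∀ x y, (x, y) ∈ S → (x, y) ∈ planarPoints (convexHull ℚ (toRat '' N))) :
    UnimodularEquivalent Δ (convexHull ℚ (toRat '' N)) := by
  obtain ⟨a, b, c, d, s, t, hdet, h⟩ := h
  have hu : IsUnit (!![a, b; c, d] : Matrix (Fin 2) (Fin 2) ℤ).det := by
    rw [Matrix.det_fin_two_of]
    exact Int.isUnit_iff.2 hdet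
  refine ⟨Matrix.GeneralLinearGroup.mk'' _ hu, ![s, t], ?_⟩
  change Δ = affineMap !![a, b; c, d] ![s, t] '' _
  have hφ : ∀ x y : ℤ, affineMap !![a, b; c, d] ![s, t] (toRat ![x, y]) =
      toRat ![a * x + b * y + s, c * x + d * y + t] := by
    intro x y
    rw [affineMap_toRat]
    congr 1
    ext i
    fin_cases i <;> simp [mul_comm]
  apply subset_antisymm
  · conv_lhs => rw [← hΔ.convexHull_latticePoints]
    refine convexHull_min ?_ ((convex_convexHull ..).affine_image _)
    rintro _ ⟨p, hp, rfl⟩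
    obtain ⟨x, y, hx, hy⟩ := exists_affine_preimage hdet s t (p 0) (p 1)
    refine ⟨toRat ![x, y], hS x y ((h x y).2 ?_), ?_⟩
    · rw [hx, hy]
      exact mem_planarPoints'.2 hp
    · rw [hφ, hx, hy]
      congr 1
      ext i
      fin_cases i <;> rfl
  · rw [Set.image_subset_iff]
    refine convexHull_min ?_ (hΔ.convex.affine_preimage _)
    rintro _ ⟨p, hp, rfl⟩
    have := (h _ _).1 (hN p hp)
    rw [mem_planarPoints, ← hφ] at this
    rwa [show ![p 0, p 1] = p from by ext i; fin_cases i <;> rfl] at this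

theorem UnimodularEquivalent.affineEquivalent {Q : Set (Fin 2 → ℚ)}
    (h : UnimodularEquivalent Δ Q) : AffineEquivalent (planarPoints Δ) (planarPoints Q) := by
  obtain ⟨A, t, rfl⟩ := h
  set M : Matrix (Fin 2) (Fin 2) ℤ := A.val
  have hdet : M 0 0 * M 1 1 - M 0 1 * M 1 0 = 1 ∨ M 0 0 * M 1 1 - M 0 1 * M 1 0 = -1 := by
    rw [← Matrix.det_fin_two]
    exact Int.isUnit_iff.1 ((Matrix.isUnit_iff_isUnit_det M).1 A.isUnit)
  refine ⟨M 0 0, M 0 1, M 1 0, M 1 1, t 0, t 1, hdet, fun x y => ?_⟩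
  have e : toRat ![M 0 0 * x + M 0 1 * y + t 0, M 1 0 * x + M 1 1 * y + t 1] =
      affineMap M t (toRat ![x, y]) := by
    rw [affineMap_toRat]
    congr 1
    ext i
    fin_cases i <;> simp
  have hinj : Function.Injective (affineMap M t) := by
    rw [← AffineMap.linear_injective_iff]
    change Function.Injective (M.map (Int.cast : ℤ → ℚ)).mulVec
    rw [Matrix.mulVec_injective_iff_isUnit, Matrix.isUnit_iff_isUnit_det]
    have : (M.map (Int.cast : ℤ → ℚ)).det = M.det := (Int.cast_det M).symm
    rw [this, Matrix.det_fin_two]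
    rcases hdet with hd | hd <;> simp [hd]
  rw [mem_planarPoints, mem_planarPoints, e]
  exact (hinj.mem_set_image (s := Q)).symm

theorem le_of_mem_planarPoints_convexHull {N : Set (Fin 2 → ℤ)} (u v w : ℤ)
    (h : ∀ p ∈ N, u * p 0 + v * p 1 ≤ w) {x y : ℤ}
    (hxy : (x, y) ∈ planarPoints (convexHull ℚ (toRat '' N))) : u * x + v * y ≤ w := by
  have hle : convexHull ℚ (toRat '' N) ⊆
      {z | ((u : ℚ) • LinearMap.proj (R := ℚ) (φ := fun _ : Fin 2 => ℚ) 0 +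
        (v : ℚ) • LinearMap.proj (R := ℚ) (φ := fun _ : Fin 2 => ℚ) 1) z ≤ (w : ℚ)} := by
    refine convexHull_min ?_ (convex_halfSpace_le (LinearMap.isLinear _) _)
    rintro _ ⟨p, hp, rfl⟩
    have := h p hp
    simp only [Set.mem_ofPred_eq, LinearMap.add_apply, LinearMap.smul_apply, LinearMap.proj_apply,
      toRat, smul_eq_mul]
    exact_mod_cast this
  have := hle hxy
  simp only [Set.mem_ofPred_eq, LinearMap.add_apply, LinearMap.smul_apply, LinearMap.proj_apply,
    toRat, smul_eq_mul, Matrix.cons_val] at this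
  exact_mod_cast this

theorem mem_planarPoints_convexHull {N : Set (Fin 2 → ℤ)} {x y : ℤ} (h : ![x, y] ∈ N) :
    (x, y) ∈ planarPoints (convexHull ℚ (toRat '' N)) :=
  subset_convexHull _ _ ⟨_, h, rfl⟩

end LatticePolytope

/-- On the rows y = 0 and y = 1 one has y² = y. -/
theorem onParabola_of_strip {S : Set (ℤ × ℤ)} (h : ∀ x y, (x, y) ∈ S → 0 ≤ y ∧ y ≤ 1) :
    OnParabola S := by
  refine ⟨0, 1, Or.inr one_ne_zero, 0, 0, 1, fun x y hxy => ?_⟩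
  have := h x y hxy
  rcases (show y = 0 ∨ y = 1 by omega) with rfl | rfl <;> simp

/-! ### The four types of polygons -/

namespace LatticePolytope

variable {Δ : Set (Fin 2 → ℚ)}

theorem isTypeI_or_isTypeII_onParabola (h : IsTypeI Δ ∨ IsTypeII Δ) :
    OnParabola (planarPoints Δ) := by
  rcases h with ⟨a, b, -, -, -, h⟩ | ⟨a, -, h⟩
  all_goals
    refine h.affineEquivalent.symm.onParabola (onParabola_of_strip fun x y hxy => ?_)
    have h1 := le_of_mem_planarPoints_convexHull 0 1 1 (by simp) hxy
    have h2 := le_of_mem_planarPoints_convexHull 0 (-1) 0 (by simp) hxy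
    omega

/-- The lattice points of the standard polygons of types (iii) and (iv) lie on two lines. -/
theorem onConic_kite {S : Set (ℤ × ℤ)} (δ : ℤ) (h : ∀ x y, (x, y) ∈ S → y = 0 ∨
    y = 1 ∧ x = 0 ∨ y = -1 ∧ x = δ) : OnConic S := by
  -- The conic y(2x + δy - δ) = 0: the axis and the line through (0, 1) and (δ, -1). Its equation
  -- has the value 2 at (1, 1).
  refine ⟨0, 0, -δ, 0, 2, δ, ⟨1, 1, ?_⟩, fun x y hxy => ?_⟩
  · push_cast
    ring_nf
    exact two_ne_zero
  · rcases h x y hxy with rfl | ⟨rfl, rfl⟩ | ⟨rfl, rfl⟩ <;> push_cast <;> ring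

/-- The polygons of types (iii) for `δ = 0` and (iv) for `δ = -1`. -/
def kite (δ a b : ℤ) : Set (Fin 2 → ℚ) :=
  convexHull ℚ (toRat '' {![a, 0], ![0, 1], ![-b, 0], ![δ, -1]})

theorem onConic_planarPoints_kite {δ a b : ℤ} (hδ : δ = 0 ∨ δ = -1) (ha : 1 ≤ a) (hb : 0 ≤ b) :
    OnConic (planarPoints (kite δ a b)) := by
  refine onConic_kite δ fun x y hxy => ?_
  have h1 := le_of_mem_planarPoints_convexHull 0 1 1 (by simp) hxy
  have h2 := le_of_mem_planarPoints_convexHull 0 (-1) 1 (by simp) hxy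
  -- Half-planes bounded by lines through the apexes: the first two force x = 0 at y = 1, the last
  -- two x = δ at y = -1. The slopes with a + 1 and b + 1 leave room for δ = -1 and b = 0.
  have h3 := le_of_mem_planarPoints_convexHull 1 a a (by simp; omega) hxy
  have h4 := le_of_mem_planarPoints_convexHull (-1) (b + 1) (b + 1) (by simp; omega) hxy
  have h5 := le_of_mem_planarPoints_convexHull 1 (-(a + 1)) (a + 1 + δ) (by simp; omega) hxy
  have h6 := le_of_mem_planarPoints_convexHull (-1) (-(b + 1)) (b + 1 - δ) (by simp; omega) hxy
  rcases (show y = 0 ∨ y = 1 ∨ y = -1 by omega) with rfl | rfl | rfl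
  · exact Or.inl rfl
  · exact Or.inr (Or.inl ⟨rfl, by omega⟩)
  · exact Or.inr (Or.inr ⟨rfl, by omega⟩)

theorem mem_row_kite {δ a b x : ℤ} (h : -b ≤ x) (h' : x ≤ a) :
    (x, 0) ∈ planarPoints (kite δ a b) :=
  (latticeConvex_planarPoints (convex_convexHull ..)).mem_row
    (mem_planarPoints_convexHull (by simp)) (mem_planarPoints_convexHull (by simp)) h h'

theorem not_onParabola_kite {δ a b : ℤ} (hab : 3 ≤ a + b) :
    ¬ OnParabola (planarPoints (kite δ a b)) :=
  not_onParabola_of_mem (n := -b) (δ := δ) (mem_row_kite (by omega) (by omega))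
    (mem_row_kite (by omega) (by omega)) (mem_row_kite (by omega) (by omega))
    (mem_planarPoints_convexHull (by simp)) (mem_planarPoints_convexHull (by simp))

theorem isTypeIII_or_isTypeIV_iff : IsTypeIII Δ ∨ IsTypeIV Δ ↔
    ∃ δ a b : ℤ, (δ = 0 ∨ δ = -1) ∧ 1 ≤ a ∧ 0 ≤ b ∧ 3 ≤ a + b ∧
      UnimodularEquivalent Δ (kite δ a b) := by
  constructor
  · rintro (⟨a, b, h⟩ | ⟨a, b, h⟩)
    · exact ⟨0, a, b, Or.inl rfl, h⟩
    · exact ⟨-1, a, b, Or.inr rfl, h⟩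
  · rintro ⟨δ, a, b, rfl | rfl, h⟩
    · exact Or.inl ⟨a, b, h⟩
    · exact Or.inr ⟨a, b, h⟩

theorem isTypeIII_or_isTypeIV_onConic (h : IsTypeIII Δ ∨ IsTypeIV Δ) :
    OnConic (planarPoints Δ) := by
  obtain ⟨δ, a, b, hδ, ha, hb, -, h⟩ := isTypeIII_or_isTypeIV_iff.1 h
  exact h.affineEquivalent.symm.onConic (onConic_planarPoints_kite hδ ha hb)

theorem isTypeIII_or_isTypeIV_not_onParabola (h : IsTypeIII Δ ∨ IsTypeIV Δ) :
    ¬ OnParabola (planarPoints Δ) := by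
  obtain ⟨δ, a, b, -, -, -, hab, h⟩ := isTypeIII_or_isTypeIV_iff.1 h
  exact mt h.affineEquivalent.onParabola (not_onParabola_kite hab)

theorem isTypeI_of_trapezoidPoints (hΔ : IsFullDimLatticePolytope Δ) {S : Set (ℤ × ℤ)}
    (h : AffineEquivalent (planarPoints Δ) S) (hS : TrapezoidPoints S) : IsTypeI Δ := by
  obtain ⟨a, b, ha, hab, h4, hS⟩ := hS
  refine ⟨a, b, ha, hab, h4, unimodularEquivalent_of_affineEquivalent hΔ h _ ?_ ?_⟩
  · simp [hS]
    omega
  · intro x y hxy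
    have hconv := latticeConvex_planarPoints (convex_convexHull ℚ
      (toRat '' {![0, 0], ![0, 1], ![a, 1], ![b, 0]}))
    rcases (hS x y).1 hxy with ⟨rfl, h1, h2⟩ | ⟨rfl, h1, h2⟩
    · exact hconv.mem_row (mem_planarPoints_convexHull (by simp))
        (mem_planarPoints_convexHull (by simp)) h1 h2
    · exact hconv.mem_row (mem_planarPoints_convexHull (by simp))
        (mem_planarPoints_convexHull (by simp)) h1 h2

theorem isTypeII_of_trianglePoints (hΔ : IsFullDimLatticePolytope Δ) {S : Set (ℤ × ℤ)}
    (h : AffineEquivalent (planarPoints Δ) S) (hS : TrianglePoints S) : IsTypeII Δ := by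
  obtain ⟨a, ha, hS⟩ := hS
  refine ⟨a, ha, unimodularEquivalent_of_affineEquivalent hΔ h _ ?_ ?_⟩
  · simp [hS]
    omega
  · intro x y hxy
    rcases (hS x y).1 hxy with ⟨rfl, h1, h2⟩ | ⟨rfl, rfl⟩
    · exact (latticeConvex_planarPoints (convex_convexHull ..)).mem_row
        (mem_planarPoints_convexHull (by simp)) (mem_planarPoints_convexHull (by simp)) h1 h2
    · exact mem_planarPoints_convexHull (by simp)

theorem exists_kite_of_kitePoints (hΔ : IsFullDimLatticePolytope Δ) {S : Set (ℤ × ℤ)} {δ : ℤ}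
    (h : AffineEquivalent (planarPoints Δ) S) (hS : KitePoints δ S) :
    ∃ a b : ℤ, 1 ≤ a ∧ 0 ≤ b ∧ 3 ≤ a + b ∧ UnimodularEquivalent Δ (kite δ a b) := by
  obtain ⟨a, b, ha, hb, hab, hS⟩ := hS
  refine ⟨a, b, ha, hb, hab, unimodularEquivalent_of_affineEquivalent hΔ h _ ?_ ?_⟩
  · simp [hS]
    omega
  · intro x y hxy
    rcases (hS x y).1 hxy with ⟨rfl, h1, h2⟩ | ⟨rfl, rfl⟩ | ⟨rfl, rfl⟩
    · exact mem_row_kite h1 h2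
    · exact mem_planarPoints_convexHull (by simp)
    · exact mem_planarPoints_convexHull (by simp)

/-- A polygon with at least six lattice points has them on a conic iff it is of types (i)–(iv). -/
theorem onConic_planarPoints_iff (hΔ : IsFullDimLatticePolytope Δ)
    (hcard : 6 ≤ (latticePoints Δ).ncard) :
    OnConic (planarPoints Δ) ↔ IsTypeI Δ ∨ IsTypeII Δ ∨ IsTypeIII Δ ∨ IsTypeIV Δ := by
  constructor
  · intro h
    obtain ⟨S, hS, h1 | h2 | h3 | h4⟩ :=
      (conicConfiguration_planarPoints hΔ hcard h).classification
    · exact Or.inl (isTypeI_of_trapezoidPoints hΔ hS h1)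
    · exact Or.inr (Or.inl (isTypeII_of_trianglePoints hΔ hS h2))
    · exact Or.inr (Or.inr (Or.inl (exists_kite_of_kitePoints hΔ hS h3)))
    · exact Or.inr (Or.inr (Or.inr (exists_kite_of_kitePoints hΔ hS h4)))
  · rintro (h | h | h)
    · exact (isTypeI_or_isTypeII_onParabola (Or.inl h)).onConic
    · exact (isTypeI_or_isTypeII_onParabola (Or.inr h)).onConic
    · exact isTypeIII_or_isTypeIV_onConic h

/-- Such a curve is a conic, so the classification applies, and types (iii) and (iv) are excluded by
three consecutive points on the axis and the two apexes. -/
theorem onParabola_planarPoints_iff (hΔ : IsFullDimLatticePolytope Δ)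
    (hcard : 6 ≤ (latticePoints Δ).ncard) :
    OnParabola (planarPoints Δ) ↔ IsTypeI Δ ∨ IsTypeII Δ := by
  refine ⟨fun h => ?_, isTypeI_or_isTypeII_onParabola⟩
  rcases (onConic_planarPoints_iff hΔ hcard).1 h.onConic with h' | h' | h'
  · exact Or.inl h'
  · exact Or.inr h'
  · exact absurd h (isTypeIII_or_isTypeIV_not_onParabola h')

theorem baseLocus_nonempty_iff_onParabola (hΔ : IsFullDimLatticePolytope Δ)
    (hnt : (latticePoints Δ).Nontrivial) :
    (baseLocus (latticePoints Δ) 2).Nonempty ↔ OnParabola (planarPoints Δ) := by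
  rw [baseLocus_nonempty_iff hΔ hnt]
  constructor
  · rintro ⟨s, t, hst, α, β, γ, h⟩
    exact ⟨s, t, hst, α, β, γ, fun x y hxy => by simpa using h ![x, y] hxy⟩
  · rintro ⟨s, t, hst, α, β, γ, h⟩
    exact ⟨s, t, hst, α, β, γ, fun p hp => h _ _ (mem_planarPoints'.2 hp)⟩

end LatticePolytope

theorem mainTheorem2 (Δ : Set (Fin 2 → ℚ)) (hΔ : IsFullDimLatticePolytope Δ)
    (hcard : 6 ≤ (latticePoints Δ).ncard) :
    List.TFAE [
      ¬ IsFullDimensionalForm (latticePoints Δ) 2,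
      IsSpecial (latticePoints Δ) 3,
      IsTypeI Δ ∨ IsTypeII Δ ∨ IsTypeIII Δ ∨ IsTypeIV Δ] ∧
    ((baseLocus (latticePoints Δ) 2).Nonempty ↔ IsTypeI Δ ∨ IsTypeII Δ) := by
  have hnt : (latticePoints Δ).Nontrivial :=
    (Set.one_lt_ncard (Set.finite_of_ncard_pos (by omega))).1 (by omega)
  have h3 : ¬ NotOnConic (latticePoints Δ) ↔
      IsTypeI Δ ∨ IsTypeII Δ ∨ IsTypeIII Δ ∨ IsTypeIV Δ := by
    rw [notOnConic_iff, not_not, onConic_planarPoints_iff hΔ hcard]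
  refine ⟨?_, ?_⟩
  · rw [isFullDimensionalForm_iff hΔ hnt, isSpecial_iff hΔ hcard, h3]
    tfae_finish
  · rw [baseLocus_nonempty_iff_onParabola hΔ hnt, onParabola_planarPoints_iff hΔ hcard]
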